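/- **Setting.** Let $(\mathcal S,\mathcal A,p,r,\mu)$ be a finite MDP with sink state $e$: $p(e,a,e)=1$, $r(e,a,e)=0$ for all $a\in\mathcal A\ne\emptyset$, and $\mu(e)=0$. Let $\Pi=\mathcal A^{\mathcal S}$ be the set of stationary deterministic policies, and assume the MDP is transient: $\sum_{t\ge 0}\mathbb P^{\pi,s}[\tilde s_t=s']<\infty$ for all $\pi\in\Pi$ and $s,s'\in\mathcal S\setminus\{e\}$. Write $X_t=\sum_{k<t}r(\tilde s_k,\tilde a_k,\tilde s_{k+1})$, $\mathrm{ERM}_\beta[X]=-\beta^{-1}\log\mathbb E\,e^{-\beta X}$, $\mathrm{EVaR}_\alpha[X]=\sup_{\beta>0}(\mathrm{ERM}_\beta[X]+\beta^{-1}\log\alpha)$, and $$h(\pi,\beta)=\lim_{t\to\infty}\mathrm{ERM}_\beta^{\pi,\mu}[X_t]+\beta^{-1}\log\alpha\in[-\infty,\infty),\qquad h^\star(\beta)=\max_{\pi\in\Pi}h(\pi,\beta).$$ **Grid.** For $\alpha\in(0,1)$, $\delta>0$, $\beta_0>0$ let $\mathcal B(\beta_0,\delta)=\{\beta_0,\dots,\beta_K\}$,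 where $\beta_{k+1}=\beta_k\log\frac1\alpha\,/\,(\log\frac1\alpha-\beta_k\delta)$ and $K$ is the least index with $\beta_K\ge\delta^{-1}\log\frac1\alpha$. **Algorithm.** Given a stream of samples $(\tilde s_i,\tilde a_i,\tilde s'_i)$, step sizes $\tilde\eta_i$ $(i\in\mathbb N)$ and bounds $z_{\min}(\beta),z_{\max}(\beta)\in\mathbb R$, ERM Q-learning for the risk level $\beta$ starts from $\tilde q_0(\cdot,\cdot,\beta)=0$. At step $i$ it computes the TD residual $\tilde z_i(\beta)=r(\tilde s_i,\tilde a_i,\tilde s'_i)+\max_{a'}\tilde q_i(\tilde s'_i,a',\beta)-\tilde q_i(\tilde s_i,\tilde a_i,\beta)$. If $\tilde z_i(\beta)\notin[z_{\min}(\beta),z_{\max}(\beta)]$ it stops and returns $-\infty$; otherwise it sets $\tilde q_{i+1}(\tilde s_i,\tilde a_i,\beta)=\tilde q_i(\tilde s_i,\tilde a_i,\beta)-\tilde\eta_i(e^{-\beta\tilde z_i(\beta)}-1)$ and leaves all other entries unchanged. EVaR Q-learning runs this for every $\beta\in\mathcal B(\beta_0,\delta)$ on the same stream. From estimates $q(\cdot,\cdot,\beta)$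 it forms $\hat h(\beta)=\mathrm{ERM}_\beta^{\mu}[\max_a q(\tilde s_0,a,\beta)]+\beta^{-1}\log\alpha$ (with $\hat h(\beta)=-\infty$ if the run returned $-\infty$), picks a maximizer $\hat\beta$ of $\hat h$ over $\mathcal B(\beta_0,\delta)$, and outputs a policy $\pi$ with $\pi(s)\in\arg\max_a q(s,a,\hat\beta)$ for all $s$ (an arbitrary policy if the run for $\hat\beta$ returned $-\infty$). Ties are broken arbitrarily. **Theorem.** For every such MDP, $\alpha\in(0,1)$ and $\delta>0$ there is $\bar\beta>0$ such that the following holds for every $\beta_0\in(0,\bar\beta]$. Assume that almost surely: 1. for all $i\in\mathbb N$ and $s'\in\mathcal S$, $\mathbb P[\tilde s'_i=s'\mid \tilde s_i,\tilde a_i,\tilde\eta_i,(\tilde\eta_l,\tilde s_l,\tilde a_l,\tilde s'_l)_{l<i}]=p(\tilde s_i,\tilde a_i,s')$; 2. $\tilde\eta_i\ge 0$ for all $i$, and for all $s\in\mathcal S\setminus\{e\}$, $a\in\mathcal A$: $\sum_{i:(\tilde s_i,\tilde a_i)=(s,a)}\tilde\eta_i=\infty$ and $\sum_{i:(\tilde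 s_i,\tilde a_i)=(s,a)}\tilde\eta_i^2<\infty$; 3. for every $\beta\in\mathcal B(\beta_0,\delta)$ with $h^\star(\beta)>-\infty$, $\tilde z_i(\beta)\in[z_{\min}(\beta),z_{\max}(\beta)]$ for all $i$. Then, almost surely: * for every $\beta\in\mathcal B(\beta_0,\delta)$, the run for $\beta$ either never stops and $\tilde q_i(\cdot,\cdot,\beta)$ converges to a finite limit $q_\infty(\cdot,\cdot,\beta)$, or it returns $-\infty$ after finitely many steps; in both cases the resulting limit value of $\hat h(\beta)$ equals $h^\star(\beta)$; * every policy that EVaR Q-learning outputs from these limits is $\delta$-optimal, and for all sufficiently large $i$ every policy that it outputs from the iterates $\tilde q_i$ is $\delta$-optimal. Here $\pi^\star\in\Pi$ is $\delta$-optimal if $\lim_{t\to\infty}\mathrm{EVaR}_\alpha^{\pi,\mu}[X_t]$ exists and is finite for every $\pi\in\Pi$, and $\lim_{t\to\infty}\mathrm{EVaR}_\alpha^{\pi^\star,\mu}[X_t]\ \ge\ \max_{\pi\in\Pi}\lim_{t\to\infty}\mathrm{EVaR}_\alpha^{\pi,\mu}[X_t]-\delta.$ -/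

import Mathlib

open MeasureTheory Filter Topology

noncomputable section

namespace TRC

/-- A finite Markov decision process with a reward-free absorbing sink state `sink`
that carries no initial mass. -/
structure MDP (S A : Type*) [Fintype S] where
  p : S → A → S → ℝ
  r : S → A → S → ℝ
  μ : S → ℝ
  sink : S
  p_nonneg : ∀ s a s', 0 ≤ p s a s'
  p_sum : ∀ s a, ∑ s', p s a s' = 1
  μ_nonneg : ∀ s, 0 ≤ μ s
  μ_sum : ∑ s, μ s = 1
  p_sink : ∀ a, p sink a sink = 1
  r_sink : ∀ a, r sink a sink = 0
  μ_sink : μ sink = 0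

/-- Entropic risk measure of the random variable `X` on a finite set with probability
weights `w`. -/
def erm {X : Type*} [Fintype X] (w : X → ℝ) (β : ℝ) (f : X → ℝ) : ℝ :=
  -β⁻¹ * Real.log (∑ x, w x * Real.exp (-β * f x))

/-- Entropic value-at-risk, as a supremum in the extended reals. -/
def evar {X : Type*} [Fintype X] (w : X → ℝ) (α : ℝ) (f : X → ℝ) : EReal :=
  ⨆ (β : ℝ) (_ : 0 < β), ((erm w β f + β⁻¹ * Real.log α : ℝ) : EReal)

section Model

variable {S A : Type*} [Fintype S]

/-- Law of the first `t + 1` states of the chain that the stationary deterministic policy `π`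
induces from the initial distribution `ν`. -/
def pathLaw (M : MDP S A) (π : S → A) (ν : S → ℝ) (t : ℕ) (x : Fin (t + 1) → S) : ℝ :=
  ν (x 0) * ∏ k : Fin t, M.p (x k.castSucc) (π (x k.castSucc)) (x k.succ)

/-- Reward collected in the first `t` steps along a path. -/
def pathReward (M : MDP S A) (π : S → A) (t : ℕ) (x : Fin (t + 1) → S) : ℝ :=
  ∑ k : Fin t, M.r (x k.castSucc) (π (x k.castSucc)) (x k.succ)

/-- `P^{π,s}[s_t = s']`. -/
def stateProb [DecidableEq S] (M : MDP S A) (π : S → A) (s : S) (t : ℕ) (s' : S) : ℝ :=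
  ∑ x : Fin (t + 1) → S,
    if x (Fin.last t) = s' then pathLaw M π (Pi.single s 1) t x else 0

/-- Every stationary deterministic policy has finite expected occupation of every pair of
non-sink states. -/
def Transient [DecidableEq S] (M : MDP S A) : Prop :=
  ∀ π : S → A, ∀ s s' : S, s ≠ M.sink → s' ≠ M.sink →
    Summable fun t : ℕ => stateProb M π s t s'

/-- `t`-step EVaR objective of a policy. -/
def evarReturn (M : MDP S A) (α : ℝ) (π : S → A) (t : ℕ) : EReal :=
  evar (pathLaw M π M.μ t) α (pathReward M π t)

/-- ERM total-reward objective. The limit over the horizon always exists in `[-∞, ∞)` for the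
models considered; it is written as a `liminf` to have a total definition. -/
def ermTotal (M : MDP S A) (β : ℝ) (π : S → A) : EReal :=
  liminf (fun t : ℕ => ((erm (pathLaw M π M.μ t) β (pathReward M π t) : ℝ) : EReal)) atTop

/-- `h(π, β)`. -/
def hVal (M : MDP S A) (α : ℝ) (π : S → A) (β : ℝ) : EReal :=
  ermTotal M β π + ((β⁻¹ * Real.log α : ℝ) : EReal)

/-- `h⋆(β) = max_π h(π, β)`. -/
def hStar (M : MDP S A) (α β : ℝ) : EReal :=
  ⨆ π : S → A, hVal M α π β

/-- For every policy the EVaR total-reward objective exists as a finite limit, and the value of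
`π` is within `δ` of the value of every stationary policy. -/
def DeltaOptimal (M : MDP S A) (α δ : ℝ) (π : S → A) : Prop :=
  ∃ V : (S → A) → ℝ,
    (∀ π' : S → A, Tendsto (evarReturn M α π') atTop (𝓝 ((V π' : ℝ) : EReal))) ∧
    ∀ π' : S → A, V π' - δ ≤ V π

end Model

/-- The points `β_k` of the discretization of the risk level. -/
def gridPt (α δ β₀ : ℝ) : ℕ → ℝ
  | 0 => β₀
  | k + 1 => gridPt α δ β₀ k * Real.log (1 / α) /
      (Real.log (1 / α) - gridPt α δ β₀ k * δ)

/-- The least index `K` with `β_K ≥ log (1/α) / δ`. -/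
def gridLast (α δ β₀ : ℝ) : ℕ :=
  sInf {k : ℕ | Real.log (1 / α) / δ ≤ gridPt α δ β₀ k}

/-- The grid `{β_0, …, β_K}`. -/
def grid (α δ β₀ : ℝ) : Finset ℝ :=
  (Finset.range (gridLast α δ β₀ + 1)).image (gridPt α δ β₀)

section Algorithm

variable {S A : Type*} [Fintype S] [Fintype A] [Nonempty A]

/-- `max_a q(s, a)`. -/
def maxQ (q : S → A → ℝ) (s : S) : ℝ :=
  Finset.univ.sup' Finset.univ_nonempty (q s)

/-- TD residual of the transition `(s, a, s')`. -/
def tdResidual (M : MDP S A) (q : S → A → ℝ) (s : S) (a : A) (s' : S) : ℝ :=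
  M.r s a s' + maxQ q s' - q s a

open Classical in
/-- One step of ERM Q-learning; the value `none` means that the run has returned `-∞` since a
TD residual left `[zmin, zmax]`. -/
def qStep (M : MDP S A) (β zmin zmax η : ℝ) (s : S) (a : A) (s' : S) :
    Option (S → A → ℝ) → Option (S → A → ℝ)
  | none => none
  | some q =>
      if zmin ≤ tdResidual M q s a s' ∧ tdResidual M q s a s' ≤ zmax then
        some fun x b =>
          if x = s ∧ b = a then
            q x b - η * (Real.exp (-β * tdResidual M q s a s') - 1)
          else q x b
      else none

/-- The ERM Q-learning iterates for one risk level `β` on a stream of samples. -/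
def qIter (M : MDP S A) (β zmin zmax : ℝ) (η : ℕ → ℝ) (s : ℕ → S) (a : ℕ → A) (s' : ℕ → S) :
    ℕ → Option (S → A → ℝ)
  | 0 => some fun _ _ => 0
  | i + 1 => qStep M β zmin zmax (η i) (s i) (a i) (s' i) (qIter M β zmin zmax η s a s' i)

/-- The estimate of `h⋆(β)` obtained from an estimate of the state-action values. -/
def hEst (M : MDP S A) (α β : ℝ) : Option (S → A → ℝ) → EReal
  | none => ⊥
  | some q => ((erm M.μ β (maxQ q) + β⁻¹ * Real.log α : ℝ) : EReal)

/-- `π` is greedy with respect to the estimate (any policy, if the run returned `-∞`). -/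
def Greedy : Option (S → A → ℝ) → (S → A) → Prop
  | none, _ => True
  | some q, π => ∀ s a, q s a ≤ q s (π s)

/-- `π` is a possible output of EVaR Q-learning, given the estimates `Q β` for the risk levels
`β` in `B`: it is greedy for a risk level that maximizes the estimate of `h⋆` over `B`. -/
def EvarOutput (M : MDP S A) (α : ℝ) (B : Finset ℝ) (Q : ℝ → Option (S → A → ℝ))
    (π : S → A) : Prop :=
  ∃ β ∈ B, (∀ β' ∈ B, hEst M α β' (Q β') ≤ hEst M α β (Q β)) ∧ Greedy (Q β) π

/-- Convergence of a run: it never stops and its values converge to the given ones, or it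
has returned `-∞` from some time on. -/
def RunConverges (run : ℕ → Option (S → A → ℝ)) : Option (S → A → ℝ) → Prop
  | none => ∀ᶠ i in atTop, run i = none
  | some q => ∃ qs : ℕ → S → A → ℝ, (∀ i, run i = some (qs i)) ∧ Tendsto qs atTop (𝓝 q)

end Algorithm

section Sampling

variable {S A Ω : Type*}

/-- The σ-algebra generated by `η_i`, `s_i`, `a_i` and by `η_l`, `s_l`, `a_l`, `s'_l`
for `l < i`. -/
abbrev history (η : ℕ → Ω → ℝ) (s : ℕ → Ω → S) (a : ℕ → Ω → A) (s' : ℕ → Ω → S) (i : ℕ) :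
    MeasurableSpace Ω :=
  (MeasurableSpace.comap (η i) inferInstance ⊔ MeasurableSpace.comap (s i) ⊤ ⊔
      MeasurableSpace.comap (a i) ⊤) ⊔
    ⨆ l : Fin i, (MeasurableSpace.comap (η l) inferInstance ⊔ MeasurableSpace.comap (s l) ⊤ ⊔
      MeasurableSpace.comap (a l) ⊤ ⊔ MeasurableSpace.comap (s' l) ⊤)

/-- The stream of samples and step sizes consists of random variables, and the next state of
each sample is drawn from the transition probabilities given the past. -/
structure IsSampleStream [mΩ : MeasurableSpace Ω] [Fintype S] (M : MDP S A) (P : Measure Ω)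
    (η : ℕ → Ω → ℝ) (s : ℕ → Ω → S) (a : ℕ → Ω → A) (s' : ℕ → Ω → S) : Prop where
  measurable_step : ∀ i, Measurable (η i)
  measurable_state : ∀ i, Measurable[mΩ, ⊤] (s i)
  measurable_action : ∀ i, Measurable[mΩ, ⊤] (a i)
  measurable_next : ∀ i, Measurable[mΩ, ⊤] (s' i)
  transition : ∀ i, ∀ x : S,
    P[Set.indicator {ω | s' i ω = x} (fun _ => (1 : ℝ)) | history η s a s' i]
      =ᵐ[P] fun ω => M.p (s i ω) (a i ω) x

open Classical in
/-- Robbins–Monro conditions along the visits of every state-action pair (non-sink state). -/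
def RobbinsMonro [MeasurableSpace Ω] [Fintype S] (M : MDP S A) (P : Measure Ω)
    (η : ℕ → Ω → ℝ) (s : ℕ → Ω → S) (a : ℕ → Ω → A) : Prop :=
  ∀ᵐ ω ∂P, (∀ i, 0 ≤ η i ω) ∧ ∀ x : S, x ≠ M.sink → ∀ b : A,
    ¬ Summable (fun i => if s i ω = x ∧ a i ω = b then η i ω else 0) ∧
    Summable (fun i => if s i ω = x ∧ a i ω = b then η i ω ^ 2 else 0)

end Sampling

end TRC

end

/-!
For a transient policy `π`, the expectation of `exp (-β X_t)` is obtained by iterating a nonnegative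
matrix all of whose non-sink states lead to the sink. Its limit is finite exactly when the matrix
admits a positive supersolution, and then it is the solution of the exponential Bellman equation,
which comparison with sub- and supersolutions makes unique.

A run that is never stopped is a Robbins–Monro scheme for this equation, with martingale noise of
summable variance. Residuals that keep leaving the bounds would almost surely be sampled, so the
possible residuals of a surviving run are eventually bounded. Since the sink is reachable under
every policy, the iterates are then bounded themselves. Their upper and lower limits are sub- and
supersolutions of the Bellman equation, hence equal, and the limit attains `h⋆(β)`. A run that
stops can do so only if `h⋆(β) = -∞`.

For EVaR, `β ↦ ERM_β` is antitone and `β⁻¹ log α` grows by exactly `δ` between neighbouring grid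
points, so the grid misses at most `δ` above `β₀`. Below a small `β₀`, `β⁻¹ log α` is so negative
that no risk level there is competitive.
-/

namespace TRC

open Matrix

section NonnegMatrix

variable {m n R : Type*} [Fintype n]

theorem mulVec_mono [Semiring R] [PartialOrder R] [IsOrderedRing R] {K : Matrix m n R}
    (hK : ∀ i j, 0 ≤ K i j) : Monotone (K *ᵥ ·) :=
  fun _ _ h i => dotProduct_le_dotProduct_of_nonneg_left h (hK i)

theorem dotProduct_pos_of_mem_stdSimplex {ν f : n → ℝ} (hν : ν ∈ stdSimplex ℝ n)
    (hf : ∀ i, 0 < f i) : 0 < ν ⬝ᵥ f := by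
  obtain ⟨i, hi, hνi⟩ : ∃ i ∈ Finset.univ, 0 < ν i :=
    Finset.exists_lt_of_sum_lt (f := fun _ => (0 : ℝ)) (by simp [hν.2])
  exact Finset.sum_pos' (fun j _ => mul_nonneg (hν.1 j) (hf j).le) ⟨i, hi, mul_pos hνi (hf i)⟩

theorem dotProduct_const_of_mem_stdSimplex {ν : n → ℝ} (hν : ν ∈ stdSimplex ℝ n) (c : ℝ) :
    (ν ⬝ᵥ fun _ => c) = c := by
  simp [dotProduct, ← Finset.sum_mul, hν.2]

variable [DecidableEq n]

theorem monotone_pow_mulVec [Semiring R] [PartialOrder R] [IsOrderedRing R] {K : Matrix n n R}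
    (hK : ∀ i j, 0 ≤ K i j) {f : n → R} (hf : f ≤ K *ᵥ f) : Monotone fun t : ℕ => K ^ t *ᵥ f :=
  monotone_nat_of_le_succ fun t => by
    simpa only [pow_succ, ← mulVec_mulVec] using mulVec_mono (pow_apply_nonneg hK t) hf

theorem antitone_pow_mulVec [Semiring R] [PartialOrder R] [IsOrderedRing R] {K : Matrix n n R}
    (hK : ∀ i j, 0 ≤ K i j) {f : n → R} (hf : K *ᵥ f ≤ f) : Antitone fun t : ℕ => K ^ t *ᵥ f :=
  antitone_nat_of_succ_le fun t => by
    simpa only [pow_succ, ← mulVec_mulVec] using mulVec_mono (pow_apply_nonneg hK t) hf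

theorem pow_row_eq_single [Semiring R] {K : Matrix n n R} {e : n} (hK : K e = Pi.single e 1)
    (t : ℕ) : (K ^ t) e = Pi.single e 1 := by
  induction t with
  | zero => ext i; simp [one_apply, Pi.single_apply, eq_comm]
  | succ t ih => rw [pow_succ, mul_apply_eq_vecMul, ih, single_one_vecMul]; exact hK

theorem sum_path_eq_dotProduct_pow_mulVec [CommSemiring R] (K : Matrix n n R) (ν f : n → R)
    (t : ℕ) :
    ∑ x : Fin (t + 1) → n,
      ν (x 0) * (∏ k : Fin t, K (x k.castSucc) (x k.succ)) * f (x (Fin.last t)) =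
      ν ⬝ᵥ (K ^ t *ᵥ f) := by
  induction t generalizing f with
  | zero =>
    rw [← (Equiv.funUnique (Fin 1) n).symm.sum_comp]
    simp [dotProduct]
  | succ t ih =>
    rw [pow_succ, ← mulVec_mulVec, ← ih, ← (Fin.snocEquiv fun _ => n).sum_comp,
      Fintype.sum_prod_type_right]
    refine Finset.sum_congr rfl fun x _ => ?_
    rw [mulVec, dotProduct, Finset.mul_sum]
    refine Finset.sum_congr rfl fun z _ => ?_
    simp only [Fin.snocEquiv, Equiv.coe_fn_mk, Fin.prod_univ_castSucc, Fin.succ_last, Fin.snoc_last,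
      Fin.snoc_castSucc, Fin.succ_castSucc]
    rw [← Fin.castSucc_zero, Fin.snoc_castSucc]
    ring

end NonnegMatrix

section Absorbing

variable {S : Type*} [DecidableEq S]

/-- `K` is a nonnegative matrix whose row at `e` is that of the identity and from every state of
which `e` can be reached along positive entries. Reachability is encoded by requiring that every
nonempty set closed under positive entries contains `e`. -/
structure IsAbsorbing (K : Matrix S S ℝ) (e : S) : Prop where
  nonneg : ∀ i j, 0 ≤ K i j
  row_eq : K e = Pi.single e 1
  mem_of_closed : ∀ Z : Set S, Z.Nonempty → (∀ i ∈ Z, ∀ j, 0 < K i j → j ∈ Z) → e ∈ Z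

namespace IsAbsorbing

variable {K : Matrix S S ℝ} {e : S}

theorem of_pos_imp {K' : Matrix S S ℝ} (hK : IsAbsorbing K e) (hnonneg : ∀ i j, 0 ≤ K' i j)
    (hrow : K' e = Pi.single e 1) (hpos : ∀ i j, 0 < K i j → 0 < K' i j) : IsAbsorbing K' e :=
  ⟨hnonneg, hrow, fun Z hne hZ => hK.mem_of_closed Z hne fun i hi j hij => hZ i hi j (hpos i j hij)⟩

variable [Fintype S]

theorem mulVec_apply_self (hK : IsAbsorbing K e) (f : S → ℝ) : (K *ᵥ f) e = f e := by
  rw [mulVec, hK.row_eq, single_one_dotProduct]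

theorem pow_mulVec_apply_self (hK : IsAbsorbing K e) (t : ℕ) (f : S → ℝ) :
    (K ^ t *ᵥ f) e = f e := by
  rw [mulVec, pow_row_eq_single hK.row_eq, single_one_dotProduct]

theorem monotone_pow_mulVec_single (hK : IsAbsorbing K e) :
    Monotone fun t : ℕ => K ^ t *ᵥ Pi.single e 1 := by
  refine monotone_pow_mulVec hK.nonneg fun i => ?_
  obtain rfl | hi := eq_or_ne i e
  · rw [hK.mulVec_apply_self]
  · rw [Pi.single_eq_of_ne hi, mulVec_single_one]
    exact hK.nonneg i e

theorem exists_pow_mulVec_single_pos (hK : IsAbsorbing K e) :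
    ∃ n : ℕ, ∀ i, 0 < (K ^ n *ᵥ Pi.single e 1) i := by
  have hpos : ∀ i, ∃ n : ℕ, 0 < (K ^ n *ᵥ Pi.single e 1) i := by
    by_contra! hne
    have he := hK.mem_of_closed {i | ∀ n : ℕ, (K ^ n *ᵥ Pi.single e 1) i ≤ 0} hne
      fun i hi j hij n => ?_
    · simpa using (he 0).not_gt
    · refine nonpos_of_mul_nonpos_right (le_trans ?_ (hi (n + 1))) hij
      rw [pow_succ', ← mulVec_mulVec]
      refine Finset.single_le_sum (f := fun j => K i j * (K ^ n *ᵥ Pi.single e 1) j)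
        (fun k _ => mul_nonneg (hK.nonneg i k) ?_) (Finset.mem_univ j)
      simpa using pow_apply_nonneg hK.nonneg n k e
  choose n hn using hpos
  exact ⟨Finset.univ.sup n, fun i => (hn i).trans_le
    (hK.monotone_pow_mulVec_single (Finset.le_sup (Finset.mem_univ i)) i)⟩

theorem exists_abs_le_smul (hK : IsAbsorbing K e) :
    ∃ n : ℕ, ∀ f : S → ℝ, f e = 0 →
      ∃ C : ℝ, |f| ≤ C • (K ^ n *ᵥ Pi.single e 1 - Pi.single e 1) := by
  obtain ⟨n, hn⟩ := hK.exists_pow_mulVec_single_pos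
  refine ⟨n, fun f hf => ?_⟩
  obtain ⟨C, hC⟩ := (Set.finite_range fun i => |f i| / (K ^ n *ᵥ Pi.single e 1) i).bddAbove
  refine ⟨C, fun i => ?_⟩
  obtain rfl | hi := eq_or_ne i e
  · rw [Pi.smul_apply, Pi.sub_apply, hK.pow_mulVec_apply_self]
    simp [hf]
  · simpa [hi] using (div_le_iff₀ (hn i)).1 (hC ⟨i, rfl⟩)

theorem tendsto_dotProduct_pow_mulVec (hK : IsAbsorbing K e) {ν : S → ℝ} (hν : 0 ≤ ν) {W : ℝ}
    (hW : Tendsto (fun t : ℕ => ν ⬝ᵥ (K ^ t *ᵥ Pi.single e 1)) atTop (𝓝 W)) (f : S → ℝ) :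
    Tendsto (fun t : ℕ => ν ⬝ᵥ (K ^ t *ᵥ f)) atTop (𝓝 (W * f e)) := by
  obtain ⟨n, hn⟩ := hK.exists_abs_le_smul
  obtain ⟨C, hC⟩ := hn (f - f e • Pi.single e 1) (by simp)
  have hincr : Tendsto (fun t : ℕ => C * (ν ⬝ᵥ (K ^ (t + n) *ᵥ Pi.single e 1) -
      ν ⬝ᵥ (K ^ t *ᵥ Pi.single e 1))) atTop (𝓝 0) := by
    simpa using ((hW.comp (tendsto_add_atTop_nat n)).sub hW).const_mul C
  have hmono (t : ℕ) {g h : S → ℝ} (hgh : g ≤ h) : ν ⬝ᵥ (K ^ t *ᵥ g) ≤ ν ⬝ᵥ (K ^ t *ᵥ h) :=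
    dotProduct_le_dotProduct_of_nonneg_left (mulVec_mono (pow_apply_nonneg hK.nonneg t) hgh) hν
  have hrest : Tendsto (fun t : ℕ => ν ⬝ᵥ (K ^ t *ᵥ (f - f e • Pi.single e 1))) atTop (𝓝 0) := by
    refine squeeze_zero_norm (fun t => ?_) hincr
    rw [Real.norm_eq_abs, abs_le', ← dotProduct_neg, ← mulVec_neg]
    simpa only [mulVec_smul, dotProduct_smul, mulVec_sub, dotProduct_sub, smul_eq_mul, pow_add,
      mulVec_mulVec] using
      And.intro (hmono t ((le_abs_self _).trans hC)) (hmono t ((neg_le_abs _).trans hC))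
  simpa [mulVec_sub, mulVec_smul, dotProduct_sub, mul_comm] using
    hrest.add (hW.mul_const (f e))

theorem tendsto_atTop_or_exists_tendsto (hK : IsAbsorbing K e) {ν : S → ℝ}
    (hν : ν ∈ stdSimplex ℝ S) :
    Tendsto (fun t : ℕ => ν ⬝ᵥ (K ^ t *ᵥ 1)) atTop atTop ∨
      ∃ W : ℝ, 0 < W ∧
        ∀ f : S → ℝ, Tendsto (fun t : ℕ => ν ⬝ᵥ (K ^ t *ᵥ f)) atTop (𝓝 (W * f e)) := by
  have hmono : Monotone fun t : ℕ => ν ⬝ᵥ (K ^ t *ᵥ Pi.single e 1) := fun _ _ h =>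
    dotProduct_le_dotProduct_of_nonneg_left (hK.monotone_pow_mulVec_single h) hν.1
  refine (tendsto_atTop_of_monotone hmono).imp (fun h => ?_) fun ⟨W, hW⟩ => ?_
  · refine tendsto_atTop_mono (fun t => ?_) h
    refine dotProduct_le_dotProduct_of_nonneg_left
      (mulVec_mono (pow_apply_nonneg hK.nonneg t) ?_) hν.1
    exact update_le_iff.2 ⟨le_rfl, fun _ _ => zero_le_one⟩
  · obtain ⟨n, hn⟩ := hK.exists_pow_mulVec_single_pos
    exact ⟨W, (dotProduct_pos_of_mem_stdSimplex hν hn).trans_le (hmono.ge_of_tendsto hW n),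
      hK.tendsto_dotProduct_pow_mulVec hν.1 hW⟩

theorem exists_tendsto_of_mulVec_le (hK : IsAbsorbing K e) {ν : S → ℝ} (hν : ν ∈ stdSimplex ℝ S)
    {f : S → ℝ} (hf0 : ∀ i, 0 < f i) (hf : K *ᵥ f ≤ f) :
    ∃ W : ℝ, 0 < W ∧
      ∀ g : S → ℝ, Tendsto (fun t : ℕ => ν ⬝ᵥ (K ^ t *ᵥ g)) atTop (𝓝 (W * g e)) := by
  refine (hK.tendsto_atTop_or_exists_tendsto hν).resolve_left fun h => ?_
  obtain ⟨C, hC⟩ := (Set.finite_range fun i => 1 / f i).bddAbove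
  have hle : (1 : S → ℝ) ≤ C • f := fun i => (div_le_iff₀ (hf0 i)).1 (hC ⟨i, rfl⟩)
  have hC0 : 0 ≤ C := (div_pos one_pos (hf0 e)).le.trans (hC ⟨e, rfl⟩)
  refine not_tendsto_atTop_of_tendsto_nhds (tendsto_const_nhds (x := ν ⬝ᵥ (C • f)))
    (tendsto_atTop_mono (fun t => dotProduct_le_dotProduct_of_nonneg_left ?_ hν.1) h)
  refine (mulVec_mono (pow_apply_nonneg hK.nonneg t) hle).trans ?_
  simpa [mulVec_smul] using
    smul_le_smul_of_nonneg_left (antitone_pow_mulVec hK.nonneg hf (Nat.zero_le t)) hC0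

/-- If the largest ratio `g i / f i` exceeded `1`, the set where it is attained would be closed
under positive entries and hence contain `e`. -/
theorem le_of_mulVec_le (hK : IsAbsorbing K e) {f g : S → ℝ} (hf0 : ∀ i, 0 < f i)
    (hf : K *ᵥ f ≤ f) (hg : g ≤ K *ᵥ g) (hfg : g e ≤ f e) : g ≤ f := by
  have : Nonempty S := ⟨e⟩
  obtain ⟨i₀, hi₀⟩ := Finite.exists_max fun i => g i / f i
  set c := g i₀ / f i₀
  have hgc (i : S) : g i ≤ c * f i := (div_le_iff₀ (hf0 i)).1 (hi₀ i)
  suffices hc : c ≤ 1 from fun i => (hgc i).trans (mul_le_of_le_one_left (hf0 i).le hc)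
  by_contra! hc
  have he : g e = c * f e := by
    refine hK.mem_of_closed {i | g i = c * f i} ⟨i₀, (div_mul_cancel₀ _ (hf0 i₀).ne').symm⟩
      fun i (hi : g i = c * f i) j hij => ?_
    have hnonneg (k : S) : 0 ≤ K i k * (c * f k - g k) :=
      mul_nonneg (hK.nonneg i k) (sub_nonneg.2 (hgc k))
    have hsum : ∑ k, K i k * (c * f k - g k) = c * (K *ᵥ f) i - (K *ᵥ g) i := by
      simp only [mul_sub, Finset.sum_sub_distrib, mulVec, dotProduct, Finset.mul_sum,
        mul_left_comm]
    have hsum_le : ∑ k, K i k * (c * f k - g k) ≤ 0 := by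
      rw [hsum, sub_nonpos]
      calc c * (K *ᵥ f) i ≤ c * f i := by gcongr; exact hf i
        _ = g i := hi.symm
        _ ≤ (K *ᵥ g) i := hg i
    have hj := (Finset.sum_eq_zero_iff_of_nonneg fun k _ => hnonneg k).1
      (hsum_le.antisymm (Finset.sum_nonneg fun k _ => hnonneg k)) j (Finset.mem_univ j)
    exact (sub_eq_zero.1 ((mul_eq_zero.1 hj).resolve_left hij.ne')).symm
  exact (lt_mul_of_one_lt_left (hf0 e) hc).not_ge (he ▸ hfg)

/-- On a closed set without `e`, a minimizer of `m` would violate the strict decrease. -/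
theorem of_mulVec_lt {P : Matrix S S ℝ} (hP : P ∈ rowStochastic ℝ S) (hrow : P e = Pi.single e 1)
    {m : S → ℝ} (hm : ∀ i, i ≠ e → (P *ᵥ m) i < m i) : IsAbsorbing P e := by
  refine ⟨hP.1, hrow, fun Z hne hZ => ?_⟩
  obtain ⟨i, hi, hmin⟩ := Set.exists_min_image Z m Z.toFinite hne
  by_contra he
  refine (hm i fun h => he (h ▸ hi)).not_ge ?_
  calc m i = ∑ j, P i j * m i := by rw [← Finset.sum_mul, sum_row_of_mem_rowStochastic hP, one_mul]
    _ ≤ (P *ᵥ m) i := Finset.sum_le_sum fun j _ => ?_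
  obtain hij | hij := (hP.1 i j).eq_or_lt
  · simp [← hij]
  · exact mul_le_mul_of_nonneg_left (hmin j (hZ i hi j hij)) hij.le

end IsAbsorbing

variable [Fintype S]

/-- Expected number of steps that a chain with transition matrix `P` spends outside `e` when it
starts in `s`; equivalently, the expected time until it is absorbed in `e`. -/
noncomputable def absorptionTime (P : Matrix S S ℝ) (e s : S) : ℝ :=
  ∑ s' ∈ Finset.univ.erase e, ∑' t : ℕ, (P ^ t) s s'

theorem absorptionTime_nonneg {P : Matrix S S ℝ} (hP : ∀ i j, 0 ≤ P i j) (e s : S) :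
    0 ≤ absorptionTime P e s :=
  Finset.sum_nonneg fun s' _ => tsum_nonneg fun t => pow_apply_nonneg hP t s s'

theorem absorptionTime_eq {P : Matrix S S ℝ} {e : S}
    (hP : ∀ s s', s' ≠ e → Summable fun t : ℕ => (P ^ t) s s') {s : S} (hs : s ≠ e) :
    absorptionTime P e s = 1 + (P *ᵥ absorptionTime P e) s := by
  have hstep : ∀ s' ∈ Finset.univ.erase e, ∑' t : ℕ, (P ^ t) s s' =
      (if s = s' then 1 else 0) + ∑ s'', P s s'' * ∑' t : ℕ, (P ^ t) s'' s' := by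
    intro s' hs'
    replace hs' := Finset.ne_of_mem_erase hs'
    rw [(hP s s' hs').tsum_eq_zero_add, pow_zero, one_apply]
    simp only [← tsum_mul_left]
    rw [← Summable.tsum_finsetSum fun i _ => (hP i s' hs').mul_left _]
    simp only [pow_succ', mul_apply]
  rw [absorptionTime, Finset.sum_congr rfl hstep, Finset.sum_add_distrib, Finset.sum_comm]
  congr 1
  · simp [hs]
  · simp only [mulVec, dotProduct, absorptionTime, Finset.mul_sum]

end Absorbing

theorem eq_single_of_mem_stdSimplex {X : Type*} [Fintype X] [DecidableEq X] {w : X → ℝ} {e : X}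
    (hw : w ∈ stdSimplex ℝ X) (he : w e = 1) : w = Pi.single e 1 := by
  have hsum := hw.2
  rw [← Finset.add_sum_erase _ _ (Finset.mem_univ e), he, add_eq_left,
    Finset.sum_eq_zero_iff_of_nonneg fun x _ => hw.1 x] at hsum
  ext x
  obtain rfl | hx := eq_or_ne x e
  · simp [he]
  · simpa [hx] using hsum x (Finset.mem_erase.2 ⟨hx, Finset.mem_univ x⟩)

section Erm

variable {X : Type*} [Fintype X] {w : X → ℝ}

theorem sum_mul_exp_pos (hw : w ∈ stdSimplex ℝ X) (f : X → ℝ) :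
    0 < ∑ x, w x * Real.exp (f x) :=
  dotProduct_pos_of_mem_stdSimplex hw fun x => Real.exp_pos (f x)

/-- The generalized mean of `exp (-f)` of exponent `β` increases with `β`. -/
theorem erm_antitoneOn (hw : w ∈ stdSimplex ℝ X) (f : X → ℝ) :
    AntitoneOn (fun β => erm w β f) (Set.Ioi 0) := by
  intro β (hβ : 0 < β) β' (hβ' : 0 < β') hle
  have hpos := sum_mul_exp_pos hw fun x => -β * f x
  have hmean : (∑ x, w x * Real.exp (-β * f x)) ^ (β' / β) ≤ ∑ x, w x * Real.exp (-β' * f x) := by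
    convert Real.rpow_arith_mean_le_arith_mean_rpow Finset.univ w (fun x => Real.exp (-β * f x))
      (fun x _ => hw.1 x) hw.2 (fun x _ => (Real.exp_pos _).le) ((one_le_div hβ).2 hle) using 4
    rw [← Real.exp_mul]
    congr 1
    field_simp
  have hlog := Real.log_le_log (Real.rpow_pos_of_pos hpos _) hmean
  rw [Real.log_rpow hpos] at hlog
  simp only [erm, neg_mul, neg_le_neg_iff] at hlog ⊢
  calc β⁻¹ * Real.log (∑ x, w x * Real.exp (-(β * f x)))
      = β'⁻¹ * (β' / β * Real.log (∑ x, w x * Real.exp (-(β * f x)))) := by field_simp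
    _ ≤ β'⁻¹ * Real.log (∑ x, w x * Real.exp (-(β' * f x))) := by gcongr

theorem continuous_erm (hw : w ∈ stdSimplex ℝ X) (β : ℝ) : Continuous (erm w β) :=
  ((by fun_prop : Continuous fun f : X → ℝ => ∑ x, w x * Real.exp (-β * f x)).log fun f =>
    (sum_mul_exp_pos hw fun x => -β * f x).ne').const_mul _

end Erm

section PolicyMatrix

variable {S A : Type*} [Fintype S]

theorem μ_mem_stdSimplex (M : MDP S A) : M.μ ∈ stdSimplex ℝ S := ⟨M.μ_nonneg, M.μ_sum⟩

theorem p_mem_stdSimplex (M : MDP S A) (s : S) (a : A) : M.p s a ∈ stdSimplex ℝ S :=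
  ⟨M.p_nonneg s a, M.p_sum s a⟩

theorem p_sink_eq_single [DecidableEq S] (M : MDP S A) (a : A) :
    M.p M.sink a = Pi.single M.sink 1 :=
  eq_single_of_mem_stdSimplex (p_mem_stdSimplex M _ a) (M.p_sink a)

theorem exists_abs_reward_le (M : MDP S A) (π : S → A) :
    ∃ R : ℝ, 0 ≤ R ∧ ∀ s s', |M.r s (π s) s'| ≤ R := by
  obtain ⟨R, hR⟩ := (Set.finite_range fun x : S × S => |M.r x.1 (π x.1) x.2|).bddAbove
  exact ⟨R, (abs_nonneg _).trans (hR ⟨(M.sink, M.sink), rfl⟩), fun s s' => hR ⟨(s, s'), rfl⟩⟩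

/-- Transition matrix of the chain that the policy `π` induces. -/
def transMatrix (M : MDP S A) (π : S → A) : Matrix S S ℝ :=
  fun i j => M.p i (π i) j

/-- Transition matrix of the policy `π` with every entry weighted by `exp (-β r)`. Its powers
compute the exponential moments of the collected reward. -/
noncomputable def expMatrix (M : MDP S A) (β : ℝ) (π : S → A) : Matrix S S ℝ :=
  fun i j => M.p i (π i) j * Real.exp (-β * M.r i (π i) j)

variable [DecidableEq S]

theorem transMatrix_mem_rowStochastic (M : MDP S A) (π : S → A) :
    transMatrix M π ∈ rowStochastic ℝ S :=
  mem_rowStochastic_iff_sum.2 ⟨fun s => M.p_nonneg s (π s), fun s => M.p_sum s (π s)⟩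

theorem transMatrix_sink (M : MDP S A) (π : S → A) :
    transMatrix M π M.sink = Pi.single M.sink 1 :=
  p_sink_eq_single M (π M.sink)

theorem expMatrix_sink (M : MDP S A) (β : ℝ) (π : S → A) :
    expMatrix M β π M.sink = Pi.single M.sink 1 := by
  ext s
  obtain rfl | hs := eq_or_ne s M.sink
  · simp [expMatrix, M.p_sink, M.r_sink]
  · simp [expMatrix, p_sink_eq_single, hs]

omit [DecidableEq S] in
theorem pathLaw_mem_stdSimplex (M : MDP S A) (π : S → A) (t : ℕ) :
    pathLaw M π M.μ t ∈ stdSimplex ℝ (Fin (t + 1) → S) := by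
  classical
  refine ⟨fun x => mul_nonneg (M.μ_nonneg _) (Finset.prod_nonneg fun _ _ => M.p_nonneg _ _ _), ?_⟩
  have hsum := sum_path_eq_dotProduct_pow_mulVec (transMatrix M π) M.μ 1 t
  rw [one_vecMul_of_mem_rowStochastic (pow_mem (transMatrix_mem_rowStochastic M π) t)] at hsum
  simpa [dotProduct, transMatrix, pathLaw, M.μ_sum] using hsum

theorem sum_pathLaw_mul_exp (M : MDP S A) (π : S → A) (β : ℝ) (t : ℕ) :
    ∑ x, pathLaw M π M.μ t x * Real.exp (-β * pathReward M π t x) =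
      M.μ ⬝ᵥ (expMatrix M β π ^ t *ᵥ 1) := by
  rw [← sum_path_eq_dotProduct_pow_mulVec]
  refine Finset.sum_congr rfl fun x _ => ?_
  simp only [pathLaw, pathReward, expMatrix, Finset.mul_sum, Real.exp_sum, Finset.prod_mul_distrib,
    Pi.one_apply, mul_one, mul_assoc]

theorem stateProb_eq_pow_apply (M : MDP S A) (π : S → A) (s : S) (t : ℕ) (s' : S) :
    stateProb M π s t s' = (transMatrix M π ^ t) s s' := by
  have h := sum_path_eq_dotProduct_pow_mulVec (transMatrix M π) (Pi.single s 1) (Pi.single s' 1) t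
  rw [single_one_dotProduct, mulVec_single_one, col_apply] at h
  rw [← h, stateProb]
  refine Finset.sum_congr rfl fun x _ => ?_
  simp [pathLaw, transMatrix, Pi.single_apply]

theorem Transient.summable_transMatrix_pow {M : MDP S A} (hM : Transient M) (π : S → A)
    {s s' : S} (hs' : s' ≠ M.sink) : Summable fun t : ℕ => (transMatrix M π ^ t) s s' := by
  obtain rfl | hs := eq_or_ne s M.sink
  · simpa only [pow_row_eq_single (transMatrix_sink M π), Pi.single_eq_of_ne hs'] using
      summable_zero
  · simpa only [stateProb_eq_pow_apply] using hM π s s' hs hs'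

theorem Transient.exists_one_add_mulVec_le {M : MDP S A} (hM : Transient M) (π : S → A) :
    ∃ m : S → ℝ, 0 ≤ m ∧ ∀ s, s ≠ M.sink → 1 + (transMatrix M π *ᵥ m) s ≤ m s :=
  ⟨absorptionTime (transMatrix M π) M.sink,
    absorptionTime_nonneg (transMatrix_mem_rowStochastic M π).1 _,
    fun _ hs => (absorptionTime_eq (fun _ _ => hM.summable_transMatrix_pow π) hs).ge⟩

theorem Transient.isAbsorbing_expMatrix {M : MDP S A} (hM : Transient M) (β : ℝ) (π : S → A) :
    IsAbsorbing (expMatrix M β π) M.sink := by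
  obtain ⟨m, -, hm⟩ := hM.exists_one_add_mulVec_le π
  have htrans : IsAbsorbing (transMatrix M π) M.sink :=
    .of_mulVec_lt (transMatrix_mem_rowStochastic M π) (transMatrix_sink M π) fun s hs => by
      linarith [hm s hs]
  exact htrans.of_pos_imp (fun s s' => mul_nonneg (M.p_nonneg _ _ _) (Real.exp_pos _).le)
    (expMatrix_sink M β π) fun s s' hp => mul_pos hp (Real.exp_pos _)

/-- A policy that stays among the states violating `C` would never reach the sink. -/
theorem Transient.induction_on {M : MDP S A} (hM : Transient M) {C : S → Prop} (sink : C M.sink)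
    (step : ∀ x, x ≠ M.sink → (∀ b, ∃ x', 0 < M.p x b x' ∧ C x') → C x) (x : S) : C x := by
  by_contra hx
  have hbad (x : S) : ¬ C x → ∃ b, ∀ x', 0 < M.p x b x' → ¬ C x' := by
    contrapose!
    obtain rfl | hne := eq_or_ne x M.sink
    · exact fun _ => sink
    · exact step x hne
  have : Nonempty A := (hbad x hx).nonempty
  choose! π hπ using hbad
  exact (hM.isAbsorbing_expMatrix 0 π).mem_of_closed {x | ¬ C x} ⟨x, hx⟩
    (fun s hs s' hpos => hπ s hs s' (by simpa [expMatrix] using hpos)) sink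

end PolicyMatrix

section ErmReturn

variable {S A : Type*} [Fintype S]

/-- `t`-step ERM objective of a policy, the counterpart of `evarReturn`. -/
noncomputable def ermReturn (M : MDP S A) (β : ℝ) (π : S → A) (t : ℕ) : ℝ :=
  erm (pathLaw M π M.μ t) β (pathReward M π t)

variable [DecidableEq S] {M : MDP S A} {β : ℝ} {π : S → A}

theorem ermReturn_eq (M : MDP S A) (β : ℝ) (π : S → A) (t : ℕ) :
    ermReturn M β π t = -β⁻¹ * Real.log (M.μ ⬝ᵥ (expMatrix M β π ^ t *ᵥ 1)) := by
  rw [ermReturn, erm, sum_pathLaw_mul_exp]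

theorem tendsto_ermReturn {W : ℝ} (hW : 0 < W)
    (h : Tendsto (fun t : ℕ => M.μ ⬝ᵥ (expMatrix M β π ^ t *ᵥ 1)) atTop (𝓝 W)) :
    Tendsto (ermReturn M β π) atTop (𝓝 (-β⁻¹ * Real.log W)) := by
  simpa only [← ermReturn_eq] using (h.log hW.ne').const_mul (-β⁻¹)

theorem ermTotal_eq_of_tendsto {W : ℝ} (hW : 0 < W)
    (h : ∀ f : S → ℝ,
      Tendsto (fun t : ℕ => M.μ ⬝ᵥ (expMatrix M β π ^ t *ᵥ f)) atTop (𝓝 (W * f M.sink))) :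
    ermTotal M β π = ((-β⁻¹ * Real.log W : ℝ) : EReal) :=
  (EReal.tendsto_coe.2 (tendsto_ermReturn hW (by simpa using h 1))).liminf_eq

theorem tendsto_ermReturn_bot (hβ : 0 < β)
    (h : Tendsto (fun t : ℕ => M.μ ⬝ᵥ (expMatrix M β π ^ t *ᵥ 1)) atTop atTop) :
    Tendsto (fun t => (ermReturn M β π t : EReal)) atTop (𝓝 ⊥) := by
  simp only [EReal.tendsto_coe_nhds_bot_iff, ermReturn_eq, neg_mul]
  exact tendsto_neg_atTop_atBot.comp
    ((Real.tendsto_log_atTop.comp h).const_mul_atTop (inv_pos.2 hβ))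

theorem ermTotal_eq_bot_of_tendsto_atTop (hβ : 0 < β)
    (h : Tendsto (fun t : ℕ => M.μ ⬝ᵥ (expMatrix M β π ^ t *ᵥ 1)) atTop atTop) :
    ermTotal M β π = ⊥ :=
  (tendsto_ermReturn_bot hβ h).liminf_eq

theorem Transient.tendsto_ermReturn (hM : Transient M) (hβ : 0 < β) (π : S → A) :
    Tendsto (fun t => (ermReturn M β π t : EReal)) atTop (𝓝 (ermTotal M β π)) := by
  rcases (hM.isAbsorbing_expMatrix β π).tendsto_atTop_or_exists_tendsto (μ_mem_stdSimplex M) with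
    hdiv | ⟨W, hW, hconv⟩
  · rw [ermTotal_eq_bot_of_tendsto_atTop hβ hdiv]
    exact tendsto_ermReturn_bot hβ hdiv
  · rw [ermTotal_eq_of_tendsto hW hconv]
    exact EReal.tendsto_coe.2 (TRC.tendsto_ermReturn hW (by simpa using hconv 1))

theorem Transient.ermTotal_ne_bot_of_mulVec_le (hM : Transient M) {w : S → ℝ}
    (hw0 : ∀ s, 0 < w s) (hw : expMatrix M β π *ᵥ w ≤ w) : ermTotal M β π ≠ ⊥ := by
  obtain ⟨W, hW, hconv⟩ :=
    (hM.isAbsorbing_expMatrix β π).exists_tendsto_of_mulVec_le (μ_mem_stdSimplex M) hw0 hw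
  rw [ermTotal_eq_of_tendsto hW hconv]
  exact EReal.coe_ne_bot _

theorem Transient.ermTotal_le_of_le_mulVec (hM : Transient M) (hβ : 0 < β) {w : S → ℝ}
    (hw0 : ∀ s, 0 < w s) (hsink : w M.sink = 1) (hw : w ≤ expMatrix M β π *ᵥ w) :
    ermTotal M β π ≤ ((-β⁻¹ * Real.log (M.μ ⬝ᵥ w) : ℝ) : EReal) := by
  have hK := hM.isAbsorbing_expMatrix β π
  rcases hK.tendsto_atTop_or_exists_tendsto (μ_mem_stdSimplex M) with hdiv | ⟨W, hW, hconv⟩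
  · exact (ermTotal_eq_bot_of_tendsto_atTop hβ hdiv).trans_le bot_le
  have hle : M.μ ⬝ᵥ w ≤ W := by
    refine ge_of_tendsto' (by simpa only [hsink, mul_one] using hconv w) fun t => ?_
    refine dotProduct_le_dotProduct_of_nonneg_left ?_ M.μ_nonneg
    simpa using monotone_pow_mulVec hK.nonneg hw (Nat.zero_le t)
  rw [ermTotal_eq_of_tendsto hW hconv, EReal.coe_le_coe_iff, neg_mul, neg_mul, neg_le_neg_iff]
  gcongr
  exact dotProduct_pos_of_mem_stdSimplex (μ_mem_stdSimplex M) hw0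

theorem Transient.ermTotal_eq_of_mulVec_eq (hM : Transient M) {w : S → ℝ}
    (hw0 : ∀ s, 0 < w s) (hsink : w M.sink = 1) (hw : expMatrix M β π *ᵥ w = w) :
    ermTotal M β π = ((-β⁻¹ * Real.log (M.μ ⬝ᵥ w) : ℝ) : EReal) := by
  obtain ⟨W, hW, hconv⟩ :=
    (hM.isAbsorbing_expMatrix β π).exists_tendsto_of_mulVec_le (μ_mem_stdSimplex M) hw0 hw.le
  have hpow (t : ℕ) : expMatrix M β π ^ t *ᵥ w = w := by
    induction t with
    | zero => simp
    | succ t ih => rw [pow_succ, ← mulVec_mulVec, hw, ih]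
  have hWw : W = M.μ ⬝ᵥ w := by
    have h := hconv w
    simp only [hpow, hsink, mul_one] at h
    exact tendsto_nhds_unique h tendsto_const_nhds
  rw [ermTotal_eq_of_tendsto hW hconv, hWw]

end ErmReturn

section SmallRisk

variable {S A : Type*} [Fintype S] {M : MDP S A} {β R : ℝ} {π : S → A} {m : S → ℝ}

/-- Jensen's inequality for `exp`. -/
theorem exp_neg_le_expMatrix_mulVec (hβ : 0 ≤ β) (hR0 : 0 ≤ R)
    (hR : ∀ s s', |M.r s (π s) s'| ≤ R)
    (hm : ∀ s, s ≠ M.sink → 1 + (transMatrix M π *ᵥ m) s ≤ m s) :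
    (fun s => Real.exp (-(β * R * m s))) ≤
      expMatrix M β π *ᵥ fun s => Real.exp (-(β * R * m s)) := by
  classical
  intro s
  obtain rfl | hs := eq_or_ne s M.sink
  · rw [mulVec, expMatrix_sink, single_one_dotProduct]
  have hmean : ∑ s', M.p s (π s) s' • (-(β * R * (1 + m s'))) =
      -(β * R * (1 + (transMatrix M π *ᵥ m) s)) := by
    simp only [smul_eq_mul, mul_neg, Finset.sum_neg_distrib, mul_left_comm (M.p _ _ _) (β * R),
      ← Finset.mul_sum]
    simp only [mul_add, Finset.sum_add_distrib, mul_one, M.p_sum]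
    rfl
  calc Real.exp (-(β * R * m s))
      ≤ Real.exp (-(β * R * (1 + (transMatrix M π *ᵥ m) s))) := by gcongr; exact hm s hs
    _ ≤ ∑ s', M.p s (π s) s' • Real.exp (-(β * R * (1 + m s'))) := by
        rw [← hmean]
        exact convexOn_exp.map_sum_le (fun _ _ => M.p_nonneg _ _ _) (M.p_sum _ _)
          fun _ _ => Set.mem_univ _
    _ ≤ _ := by
        refine Finset.sum_le_sum fun s' _ => ?_
        simp only [expMatrix, mul_assoc (M.p _ _ _), ← Real.exp_add, smul_eq_mul]
        refine mul_le_mul_of_nonneg_left (Real.exp_le_exp.2 ?_) (M.p_nonneg _ _ _)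
        nlinarith [le_of_abs_le (hR s s')]

theorem expMatrix_mulVec_le (hβ : 0 ≤ β) (hR0 : 0 ≤ R) (hR : ∀ s s', |M.r s (π s) s'| ≤ R)
    (hm0 : 0 ≤ m) (hm : ∀ s, s ≠ M.sink → 1 + (transMatrix M π *ᵥ m) s ≤ m s)
    (hβR : β * R ≤ 1) (hβm : ∀ s, β * (4 * R + 1) * m s ≤ 1) :
    (expMatrix M β π *ᵥ fun s => 1 + β * (4 * R + 1) * m s) ≤
      fun s => 1 + β * (4 * R + 1) * m s := by
  classical
  intro s
  set f : S → ℝ := fun s => 1 + β * (4 * R + 1) * m s with hf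
  have hf0 (s : S) : 0 ≤ f s := add_nonneg zero_le_one (mul_nonneg (by positivity) (hm0 s))
  obtain rfl | hs := eq_or_ne s M.sink
  · rw [mulVec, expMatrix_sink, single_one_dotProduct]
  have hmean0 : 0 ≤ (transMatrix M π *ᵥ f) s :=
    dotProduct_nonneg_of_nonneg (M.p_nonneg s (π s)) hf0
  have hmean : (transMatrix M π *ᵥ f) s = 1 + β * (4 * R + 1) * (transMatrix M π *ᵥ m) s := by
    simp only [hf, mulVec, dotProduct, mul_add, Finset.sum_add_distrib, mul_one,
      mul_left_comm (transMatrix M π s _), ← Finset.mul_sum,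
      sum_row_of_mem_rowStochastic (transMatrix_mem_rowStochastic M π)]
  have hexp : Real.exp (β * R) ≤ 1 + 2 * (β * R) := by
    have h := Real.abs_exp_sub_one_le (x := β * R) (by rwa [abs_of_nonneg (by positivity)])
    rw [abs_of_nonneg (by positivity : 0 ≤ β * R)] at h
    linarith [le_of_abs_le h]
  calc (expMatrix M β π *ᵥ f) s ≤ Real.exp (β * R) * (transMatrix M π *ᵥ f) s := by
        rw [mulVec, dotProduct, mulVec, dotProduct, Finset.mul_sum]
        refine Finset.sum_le_sum fun s' _ => ?_
        simp only [expMatrix, mul_assoc (M.p _ _ _), mul_left_comm (M.p _ _ _)]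
        have hexp_le : Real.exp (-β * M.r s (π s) s') ≤ Real.exp (β * R) :=
          Real.exp_le_exp.2 (by nlinarith [neg_le_of_abs_le (hR s s')])
        exact mul_le_mul_of_nonneg_right hexp_le (mul_nonneg (M.p_nonneg _ _ _) (hf0 s'))
    _ ≤ (1 + 2 * (β * R)) * (f s - β * (4 * R + 1)) := by
        gcongr
        rw [hmean, hf]
        nlinarith [hm s hs, mul_nonneg hβ (by positivity : 0 ≤ 4 * R + 1)]
    _ ≤ f s := by
        have h₁ : β * R * f s ≤ β * R * 2 := by
          gcongr; linarith [hβm s]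
        nlinarith [mul_nonneg (mul_nonneg hβ hR0) (mul_nonneg hβ (by positivity : 0 ≤ 4 * R + 1))]

variable [DecidableEq S]

theorem Transient.exists_ermReturn_le (hM : Transient M) (π : S → A) :
    ∃ C : ℝ, ∀ β, 0 < β → ∀ t, ermReturn M β π t ≤ C := by
  obtain ⟨m, hm0, hm⟩ := hM.exists_one_add_mulVec_le π
  obtain ⟨R, hR0, hR⟩ := exists_abs_reward_le M π
  obtain ⟨c, hc⟩ := (Set.finite_range m).bddAbove
  refine ⟨R * c, fun β hβ t => ?_⟩
  have hK := (hM.isAbsorbing_expMatrix β π).nonneg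
  have hexp : Real.exp (-(β * R * c)) ≤ M.μ ⬝ᵥ (expMatrix M β π ^ t *ᵥ 1) :=
    calc Real.exp (-(β * R * c)) = M.μ ⬝ᵥ fun _ => Real.exp (-(β * R * c)) :=
          (dotProduct_const_of_mem_stdSimplex (μ_mem_stdSimplex M) _).symm
      _ ≤ M.μ ⬝ᵥ fun s => Real.exp (-(β * R * m s)) :=
          dotProduct_le_dotProduct_of_nonneg_left
            (fun s => by gcongr; exact hc ⟨s, rfl⟩) M.μ_nonneg
      _ ≤ M.μ ⬝ᵥ (expMatrix M β π ^ t *ᵥ fun s => Real.exp (-(β * R * m s))) :=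
          dotProduct_le_dotProduct_of_nonneg_left (by
            simpa using monotone_pow_mulVec hK (exp_neg_le_expMatrix_mulVec hβ.le hR0 hR hm)
              (Nat.zero_le t)) M.μ_nonneg
      _ ≤ M.μ ⬝ᵥ (expMatrix M β π ^ t *ᵥ 1) :=
          dotProduct_le_dotProduct_of_nonneg_left
            (mulVec_mono (pow_apply_nonneg hK t) fun s => Real.exp_le_one_iff.2 <|
              neg_nonpos.2 <| mul_nonneg (by positivity) (hm0 s)) M.μ_nonneg
  have hlog := Real.log_le_log (Real.exp_pos _) hexp
  rw [Real.log_exp] at hlog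
  rw [ermReturn_eq, neg_mul, neg_le, inv_mul_eq_div, le_div_iff₀ hβ]
  linarith

theorem Transient.exists_ermTotal_ne_bot (hM : Transient M) (π : S → A) :
    ∃ β₁ : ℝ, 0 < β₁ ∧ ∀ β, 0 < β → β ≤ β₁ → ermTotal M β π ≠ ⊥ := by
  obtain ⟨m, hm0, hm⟩ := hM.exists_one_add_mulVec_le π
  obtain ⟨R, hR0, hR⟩ := exists_abs_reward_le M π
  obtain ⟨c, hc⟩ := (Set.finite_range m).bddAbove
  have hc0 : 0 ≤ c := (hm0 M.sink).trans (hc ⟨M.sink, rfl⟩)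
  refine ⟨((4 * R + 1) * (c + 1))⁻¹, by positivity, fun β hβ hβ₁ => ?_⟩
  have hβc : β * ((4 * R + 1) * (c + 1)) ≤ 1 := by
    rwa [← le_div_iff₀ (by positivity), one_div]
  have hβR : 0 ≤ β * R := by positivity
  refine hM.ermTotal_ne_bot_of_mulVec_le (w := fun s => 1 + β * (4 * R + 1) * m s) (fun s => ?_)
    (expMatrix_mulVec_le hβ.le hR0 hR hm0 hm ?_ fun s => ?_)
  · have : 0 ≤ m s := hm0 s
    positivity
  · nlinarith [mul_nonneg hβR hc0]
  · have : β * (4 * R + 1) * m s ≤ β * (4 * R + 1) * c := by gcongr; exact hc ⟨s, rfl⟩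
    nlinarith

end SmallRisk

section Grid

variable {α δ β₀ : ℝ}

theorem log_one_div_pos (hα₀ : 0 < α) (hα₁ : α < 1) : 0 < Real.log (1 / α) :=
  Real.log_pos (by rwa [lt_div_iff₀ hα₀, one_mul])

theorem inv_gridPt_eq_of_forall_lt (hα₀ : 0 < α) (hα₁ : α < 1) (hδ : 0 < δ) (hβ₀ : 0 < β₀)
    (k : ℕ) (hk : ∀ j < k, gridPt α δ β₀ j < Real.log (1 / α) / δ) :
    0 < gridPt α δ β₀ k ∧ (gridPt α δ β₀ k)⁻¹ = β₀⁻¹ - k * (δ / Real.log (1 / α)) := by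
  induction k with
  | zero => simpa [gridPt] using hβ₀
  | succ k ih =>
    obtain ⟨hpos, hinv⟩ := ih fun j hj => hk j (hj.trans k.lt_succ_self)
    have hL := log_one_div_pos hα₀ hα₁
    have hden : 0 < Real.log (1 / α) - gridPt α δ β₀ k * δ :=
      sub_pos.2 ((lt_div_iff₀ hδ).1 (hk k k.lt_succ_self))
    rw [gridPt]
    refine ⟨by positivity, ?_⟩
    push_cast
    rw [add_mul, ← sub_sub, ← hinv]
    field_simp

theorem lt_of_lt_gridLast {k : ℕ} (hk : k < gridLast α δ β₀) :
    gridPt α δ β₀ k < Real.log (1 / α) / δ :=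
  not_le.1 (Nat.notMem_of_lt_sInf (s := {k : ℕ | Real.log (1 / α) / δ ≤ gridPt α δ β₀ k}) hk)

theorem le_gridPt_gridLast (hα₀ : 0 < α) (hα₁ : α < 1) (hδ : 0 < δ) (hβ₀ : 0 < β₀) :
    Real.log (1 / α) / δ ≤ gridPt α δ β₀ (gridLast α δ β₀) := by
  have hL := log_one_div_pos hα₀ hα₁
  refine Nat.sInf_mem (s := {k : ℕ | Real.log (1 / α) / δ ≤ gridPt α δ β₀ k}) ?_
  by_contra! hempty
  obtain ⟨n, hn⟩ := exists_nat_gt (β₀⁻¹ / (δ / Real.log (1 / α)))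
  rw [div_lt_iff₀ (by positivity)] at hn
  obtain ⟨hpos, hinv⟩ := inv_gridPt_eq_of_forall_lt hα₀ hα₁ hδ hβ₀ n fun j _ =>
    not_le.1 fun hj => (hempty ▸ hj : j ∈ (∅ : Set ℕ))
  linarith [inv_pos.2 hpos]

theorem gridPt_pos (hα₀ : 0 < α) (hα₁ : α < 1) (hδ : 0 < δ) (hβ₀ : 0 < β₀) {k : ℕ}
    (hk : k ≤ gridLast α δ β₀) : 0 < gridPt α δ β₀ k :=
  (inv_gridPt_eq_of_forall_lt hα₀ hα₁ hδ hβ₀ k fun _ hj => lt_of_lt_gridLast (hj.trans_le hk)).1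

theorem inv_gridPt (hα₀ : 0 < α) (hα₁ : α < 1) (hδ : 0 < δ) (hβ₀ : 0 < β₀) {k : ℕ}
    (hk : k ≤ gridLast α δ β₀) :
    (gridPt α δ β₀ k)⁻¹ = β₀⁻¹ - k * (δ / Real.log (1 / α)) :=
  (inv_gridPt_eq_of_forall_lt hα₀ hα₁ hδ hβ₀ k fun _ hj => lt_of_lt_gridLast (hj.trans_le hk)).2

theorem gridPt_mem_grid {k : ℕ} (hk : k ≤ gridLast α δ β₀) : gridPt α δ β₀ k ∈ grid α δ β₀ :=
  Finset.mem_image_of_mem _ (Finset.mem_range.2 (Nat.lt_succ_of_le hk))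

theorem pos_of_mem_grid (hα₀ : 0 < α) (hα₁ : α < 1) (hδ : 0 < δ) (hβ₀ : 0 < β₀) {b : ℝ}
    (hb : b ∈ grid α δ β₀) : 0 < b := by
  obtain ⟨k, hk, rfl⟩ := Finset.mem_image.1 hb
  exact gridPt_pos hα₀ hα₁ hδ hβ₀ (Nat.lt_succ_iff.1 (Finset.mem_range.1 hk))

/-- The largest grid point below `β` works: the inverses of the grid points are spaced by
`δ / log (1 / α)`. -/
theorem exists_mem_grid_inv_sub_le (hα₀ : 0 < α) (hα₁ : α < 1) (hδ : 0 < δ) (hβ₀ : 0 < β₀)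
    {β : ℝ} (hβ : β₀ ≤ β) :
    ∃ b ∈ grid α δ β₀, b ≤ β ∧ b⁻¹ - δ / Real.log (1 / α) ≤ β⁻¹ := by
  have hL := log_one_div_pos hα₀ hα₁
  have hβpos := hβ₀.trans_le hβ
  by_contra! hcon
  have hle : ∀ k ≤ gridLast α δ β₀, gridPt α δ β₀ k ≤ β := by
    intro k hk
    induction k with
    | zero => simpa [gridPt] using hβ
    | succ k ih =>
      have hk' := (Nat.le_succ k).trans hk
      have hlt := hcon _ (gridPt_mem_grid hk') (ih hk')
      have hinv := inv_gridPt hα₀ hα₁ hδ hβ₀ hk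
      rw [inv_gridPt hα₀ hα₁ hδ hβ₀ hk'] at hlt
      push_cast at hinv
      refine (inv_le_inv₀ hβpos (gridPt_pos hα₀ hα₁ hδ hβ₀ hk)).1 ?_
      linarith
  have hlt := hcon _ (gridPt_mem_grid le_rfl) (hle _ le_rfl)
  have hlast : (gridPt α δ β₀ (gridLast α δ β₀))⁻¹ ≤ δ / Real.log (1 / α) := by
    rw [← inv_div]
    exact inv_anti₀ (by positivity) (le_gridPt_gridLast hα₀ hα₁ hδ hβ₀)
  linarith [inv_pos.2 hβpos]

theorem iSup_add_inv_mul_log_le (hα₀ : 0 < α) (hα₁ : α < 1) (hδ : 0 < δ) (hβ₀ : 0 < β₀)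
    {e : ℝ → EReal} (he : AntitoneOn e (Set.Ioi 0)) {C : ℝ} (hC : ∀ β, 0 < β → e β ≤ C) :
    ⨆ (β : ℝ) (_ : 0 < β), (e β + ((β⁻¹ * Real.log α : ℝ) : EReal)) ≤
      max ((C + β₀⁻¹ * Real.log α : ℝ) : EReal)
        ((grid α δ β₀).sup (fun b => e b + ((b⁻¹ * Real.log α : ℝ) : EReal)) + δ) := by
  refine iSup₂_le fun β hβ => le_max_iff.2 ?_
  have hL := log_one_div_pos hα₀ hα₁
  have hlog : Real.log α = -Real.log (1 / α) := by simp
  rcases lt_or_ge β β₀ with hlt | hge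
  · left
    rw [EReal.coe_add]
    refine add_le_add (hC β hβ) (EReal.coe_le_coe_iff.2 ?_)
    exact mul_le_mul_of_nonpos_right (inv_anti₀ hβ hlt.le) (by linarith)
  · right
    obtain ⟨b, hb, hbβ, hinv⟩ := exists_mem_grid_inv_sub_le hα₀ hα₁ hδ hβ₀ hge
    refine le_trans ?_ (add_le_add_left (Finset.le_sup hb) (δ : EReal))
    rw [add_assoc, ← EReal.coe_add]
    refine add_le_add (he (pos_of_mem_grid hα₀ hα₁ hδ hβ₀ hb) hβ hbβ) (EReal.coe_le_coe_iff.2 ?_)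
    have := mul_le_mul_of_nonneg_right hinv hL.le
    rw [sub_mul, div_mul_cancel₀ _ hL.ne'] at this
    rw [hlog]
    linarith

end Grid

theorem tendsto_add_coe {ι : Type*} {l : Filter ι} {f : ι → EReal} {y : EReal}
    (h : Tendsto f l (𝓝 y)) (c : ℝ) : Tendsto (fun i => f i + c) l (𝓝 (y + c)) :=
  (EReal.continuousAt_add (.inr (EReal.coe_ne_bot c)) (.inr (EReal.coe_ne_top c))).tendsto.comp
    (h.prodMk_nhds tendsto_const_nhds)

section Evar

variable {S A : Type*} [Fintype S] {M : MDP S A} {α δ β : ℝ} {π : S → A}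

/-- EVaR total-reward objective of a policy, in its form as a supremum of ERM objectives. -/
noncomputable def evarTotal (M : MDP S A) (α : ℝ) (π : S → A) : EReal :=
  ⨆ (β : ℝ) (_ : 0 < β), hVal M α π β

theorem hVal_le_evarTotal (hβ : 0 < β) : hVal M α π β ≤ evarTotal M α π :=
  le_iSup₂ (f := fun (β : ℝ) (_ : 0 < β) => hVal M α π β) β hβ

theorem hVal_ne_bot_iff : hVal M α π β ≠ ⊥ ↔ ermTotal M β π ≠ ⊥ := by
  simp only [hVal, ne_eq, EReal.add_eq_bot_iff, EReal.coe_ne_bot, or_false]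

theorem evarReturn_eq (M : MDP S A) (α : ℝ) (π : S → A) (t : ℕ) :
    evarReturn M α π t = ⨆ (β : ℝ) (_ : 0 < β),
      ((ermReturn M β π t : EReal) + ((β⁻¹ * Real.log α : ℝ) : EReal)) := by
  simp only [← EReal.coe_add]
  rfl

theorem ermReturn_antitoneOn (M : MDP S A) (π : S → A) (t : ℕ) :
    AntitoneOn (fun β => (ermReturn M β π t : EReal)) (Set.Ioi 0) :=
  fun _ hβ _ hβ' h => EReal.coe_le_coe_iff.2 <|
    erm_antitoneOn (pathLaw_mem_stdSimplex M π t) (pathReward M π t) hβ hβ' h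

variable [DecidableEq S]

theorem Transient.ermTotal_antitoneOn (hM : Transient M) (π : S → A) :
    AntitoneOn (fun β => ermTotal M β π) (Set.Ioi 0) :=
  fun _ hβ _ hβ' h => le_of_tendsto_of_tendsto' (hM.tendsto_ermReturn hβ' π)
    (hM.tendsto_ermReturn hβ π) fun t => ermReturn_antitoneOn M π t hβ hβ' h

theorem Transient.exists_ermTotal_le (hM : Transient M) (π : S → A) :
    ∃ C : ℝ, ∀ β, 0 < β → ermTotal M β π ≤ C :=
  (hM.exists_ermReturn_le π).imp fun _ hC β hβ =>
    le_of_tendsto' (hM.tendsto_ermReturn hβ π) fun t => EReal.coe_le_coe_iff.2 (hC β hβ t)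

theorem Transient.tendsto_hVal (hM : Transient M) (α : ℝ) (hβ : 0 < β) (π : S → A) :
    Tendsto (fun t => (ermReturn M β π t : EReal) + ((β⁻¹ * Real.log α : ℝ) : EReal)) atTop
      (𝓝 (hVal M α π β)) :=
  tendsto_add_coe (hM.tendsto_ermReturn hβ π) _

theorem tendsto_add_inv_mul_log_atBot (hα₀ : 0 < α) (hα₁ : α < 1) (C : ℝ) :
    Tendsto (fun β : ℝ => C + β⁻¹ * Real.log α) (𝓝[>] 0) atBot :=
  tendsto_atBot_add_const_left _ _
    (tendsto_inv_nhdsGT_zero.atTop_mul_const_of_neg (Real.log_neg hα₀ hα₁))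

theorem Transient.evarTotal_ne_bot (hM : Transient M) (α : ℝ) (π : S → A) :
    evarTotal M α π ≠ ⊥ := by
  obtain ⟨β, hβ, hne⟩ := hM.exists_ermTotal_ne_bot π
  exact ne_bot_of_le_ne_bot (hVal_ne_bot_iff.2 (hne β hβ le_rfl)) (hVal_le_evarTotal hβ)

theorem Transient.evarTotal_ne_top (hM : Transient M) (hα₀ : 0 < α) (hα₁ : α < 1) (π : S → A) :
    evarTotal M α π ≠ ⊤ := by
  obtain ⟨C, hC⟩ := hM.exists_ermTotal_le π
  refine ((iSup₂_le fun β hβ => ?_).trans_lt (EReal.coe_lt_top C)).ne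
  have hlog := mul_neg_of_pos_of_neg (inv_pos.2 hβ) (Real.log_neg hα₀ hα₁)
  simpa [hVal] using add_le_add (hC β hβ) (EReal.coe_nonpos.2 hlog.le)

/-- Up to `δ`, the supremum over all risk levels is attained on a finite grid, so it commutes with
the limit. -/
theorem Transient.tendsto_evarReturn (hM : Transient M) (hα₀ : 0 < α) (hα₁ : α < 1) (π : S → A) :
    Tendsto (evarReturn M α π) atTop (𝓝 (evarTotal M α π)) := by
  refine tendsto_order.2 ⟨fun y hy => ?_, fun y hy => ?_⟩
  · simp only [evarTotal, lt_iSup_iff] at hy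
    obtain ⟨β, hβ, hy⟩ := hy
    filter_upwards [(hM.tendsto_hVal α hβ π).eventually_const_lt hy] with t ht
    rw [evarReturn_eq]
    exact lt_iSup_iff.2 ⟨β, lt_iSup_iff.2 ⟨hβ, ht⟩⟩
  · obtain ⟨C, hC⟩ := hM.exists_ermReturn_le π
    lift evarTotal M α π to ℝ using ⟨hM.evarTotal_ne_top hα₀ hα₁ π, hM.evarTotal_ne_bot α π⟩
      with V hV
    obtain ⟨z, hVz, hzy⟩ := EReal.lt_iff_exists_real_btwn.1 hy
    have hδ : 0 < z - V := sub_pos.2 (EReal.coe_lt_coe_iff.1 hVz)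
    obtain ⟨β₀, hβ₀z, hβ₀ : 0 < β₀⟩ :=
      (((tendsto_add_inv_mul_log_atBot hα₀ hα₁ C).eventually_lt_atBot z).and
        self_mem_nhdsWithin).exists
    have hsup : (grid α (z - V) β₀).sup (hVal M α π) ≤ V :=
      Finset.sup_le fun b hb => hV ▸ hVal_le_evarTotal (pos_of_mem_grid hα₀ hα₁ hδ hβ₀ hb)
    have hlim := tendsto_add_coe (Tendsto.finset_sup_nhds_apply (s := grid α (z - V) β₀)
      fun b hb => hM.tendsto_hVal α (pos_of_mem_grid hα₀ hα₁ hδ hβ₀ hb) π) (z - V)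
    have hlt : (grid α (z - V) β₀).sup (hVal M α π) + ((z - V : ℝ) : EReal) < y := by
      refine (add_le_add_left hsup _).trans_lt ?_
      rwa [← EReal.coe_add, add_sub_cancel]
    filter_upwards [hlim.eventually_lt_const hlt] with t ht
    rw [evarReturn_eq]
    refine (iSup_add_inv_mul_log_le hα₀ hα₁ hδ hβ₀ (ermReturn_antitoneOn M π t)
      fun β hβ => EReal.coe_le_coe_iff.2 (hC β hβ t)).trans_lt (max_lt ?_ ht)
    exact (EReal.coe_lt_coe_iff.2 hβ₀z).trans hzy

theorem Transient.eventually_evarTotal_le (hM : Transient M) (hα₀ : 0 < α) (hα₁ : α < 1)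
    (hδ : 0 < δ) (π : S → A) :
    ∀ᶠ β₀ in 𝓝[>] 0, evarTotal M α π ≤ (grid α δ β₀).sup (hVal M α π) + δ := by
  obtain ⟨C, hC⟩ := hM.exists_ermTotal_le π
  obtain ⟨y, -, hy⟩ :=
    EReal.lt_iff_exists_real_btwn.1 (bot_lt_iff_ne_bot.2 (hM.evarTotal_ne_bot α π))
  filter_upwards [(tendsto_add_inv_mul_log_atBot hα₀ hα₁ C).eventually_lt_atBot y,
    self_mem_nhdsWithin] with β₀ hβ₀y (hβ₀ : 0 < β₀)
  refine (le_max_iff.1 (iSup_add_inv_mul_log_le hα₀ hα₁ hδ hβ₀ (hM.ermTotal_antitoneOn π)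
    hC)).resolve_left fun hle => ?_
  exact (hle.trans (EReal.coe_le_coe_iff.2 hβ₀y.le)).not_gt hy

theorem DeltaOptimal.of_hVal_eq_hStar (hM : Transient M) (hα₀ : 0 < α) (hα₁ : α < 1)
    (hβ : 0 < β) (hle : ∀ π', evarTotal M α π' ≤ hStar M α β + δ)
    (hπ : hVal M α π β = hStar M α β) : DeltaOptimal M α δ π := by
  have hcoe (π' : S → A) : ((evarTotal M α π').toReal : EReal) = evarTotal M α π' :=
    EReal.coe_toReal (hM.evarTotal_ne_top hα₀ hα₁ π') (hM.evarTotal_ne_bot α π')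
  refine ⟨fun π' => (evarTotal M α π').toReal, fun π' => ?_, fun π' => ?_⟩
  · rw [hcoe]
    exact hM.tendsto_evarReturn hα₀ hα₁ π'
  · rw [sub_le_iff_le_add, ← EReal.coe_le_coe_iff, EReal.coe_add, hcoe, hcoe]
    exact (hle π').trans (add_le_add_left (hπ ▸ hVal_le_evarTotal hβ) _)

theorem Transient.eventually_evarTotal_le_hStar [Finite A] (hM : Transient M) (hα₀ : 0 < α)
    (hα₁ : α < 1) (hδ : 0 < δ) : ∀ᶠ β₀ in 𝓝[>] 0, ∀ β ∈ grid α δ β₀,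
      (∀ β' ∈ grid α δ β₀, hStar M α β' ≤ hStar M α β) →
        ∀ π, evarTotal M α π ≤ hStar M α β + δ := by
  filter_upwards [eventually_all.2 (hM.eventually_evarTotal_le hα₀ hα₁ hδ)]
    with β₀ hβ₀ β _ hmax π
  exact (hβ₀ π).trans (add_le_add_left (Finset.sup_le fun β' hβ' =>
    (le_iSup (fun π => hVal M α π β') π).trans (hmax β' hβ')) _)

theorem Transient.hStar_ne_bot_of_evarTotal_le (hM : Transient M) {β : ℝ} {π : S → A}
    (hle : evarTotal M α π ≤ hStar M α β + δ) : hStar M α β ≠ ⊥ := fun h =>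
  hM.evarTotal_ne_bot α π (le_bot_iff.1 (by simpa only [h, EReal.bot_add] using hle))

end Evar

section MaxQ

variable {S A : Type*} [Fintype A] [Nonempty A]

theorem le_maxQ (q : S → A → ℝ) (s : S) (a : A) : q s a ≤ maxQ q s :=
  Finset.le_sup' (q s) (Finset.mem_univ a)

theorem exists_eq_maxQ (q : S → A → ℝ) (s : S) : ∃ a, maxQ q s = q s a := by
  obtain ⟨a, -, h⟩ := Finset.exists_mem_eq_sup' Finset.univ_nonempty (q s)
  exact ⟨a, h⟩

theorem maxQ_le_iff {q : S → A → ℝ} {s : S} {c : ℝ} : maxQ q s ≤ c ↔ ∀ a, q s a ≤ c := by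
  simp [maxQ, Finset.sup'_le_iff]

theorem maxQ_eq_of_greedy {q : S → A → ℝ} {π : S → A} (h : Greedy (some q) π) (s : S) :
    maxQ q s = q s (π s) :=
  le_antisymm (maxQ_le_iff.2 (h s)) (le_maxQ _ _ _)

omit [Fintype A] in
theorem exists_greedy [Finite A] (q : S → A → ℝ) : ∃ π, Greedy (some q) π := by
  choose π hπ using fun s => Finite.exists_max (q s)
  exact ⟨π, hπ⟩

theorem maxQ_eq_zero {q : S → A → ℝ} {s : S} (h : ∀ a, q s a = 0) : maxQ q s = 0 := by
  obtain ⟨a, ha⟩ := exists_eq_maxQ q s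
  rw [ha, h]

theorem exists_eventually_abs_maxQ_le {q : ℕ → S → A → ℝ} {x : S}
    (h : ∀ b, ∃ B, ∀ᶠ i in atTop, |q i x b| ≤ B) :
    ∃ B, ∀ᶠ i in atTop, |maxQ (q i) x| ≤ B := by
  choose B hB using h
  obtain ⟨B', hB'⟩ := (Set.finite_range B).bddAbove
  refine ⟨B', (eventually_all.2 hB).mono fun i hi => ?_⟩
  obtain ⟨b, hb⟩ := exists_eq_maxQ (q i) x
  exact hb ▸ (hi b).trans (hB' ⟨b, rfl⟩)

end MaxQ

section Bellman

variable {S A : Type*} [Fintype S] [Fintype A] [Nonempty A]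

/-- Expected exponential weight `exp (-β X)` of the return `X` that consists of the reward of one
step from `x` under the action `b` and of the value `max_a q(s', a)` of the next state `s'`. -/
noncomputable def bellman (M : MDP S A) (β : ℝ) (q : S → A → ℝ) (x : S) (b : A) : ℝ :=
  ∑ x', M.p x b x' * Real.exp (-β * (M.r x b x' + maxQ q x'))

theorem bellman_pos (M : MDP S A) (β : ℝ) (q : S → A → ℝ) (x : S) (b : A) :
    0 < bellman M β q x b :=
  sum_mul_exp_pos (p_mem_stdSimplex M x b) fun x' => -β * (M.r x b x' + maxQ q x')

theorem bellman_eq_mulVec (M : MDP S A) (β : ℝ) (q : S → A → ℝ) (π : S → A) (s : S) :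
    bellman M β q s (π s) = (expMatrix M β π *ᵥ fun s => Real.exp (-β * maxQ q s)) s := by
  refine Finset.sum_congr rfl fun s' _ => ?_
  simp only [expMatrix, mul_assoc, mul_add, Real.exp_add]

theorem bellman_sink (M : MDP S A) (β : ℝ) (q : S → A → ℝ) (b : A) :
    bellman M β q M.sink b = Real.exp (-β * maxQ q M.sink) := by
  classical
  simp [bellman, p_sink_eq_single, Pi.single_apply, M.r_sink]

theorem exp_mul_bellman_le (M : MDP S A) {β : ℝ} (hβ : 0 ≤ β) {q q' : S → A → ℝ} {ε : ℝ}
    (h : ∀ x b, q x b ≤ q' x b + ε) (x : S) (b : A) :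
    Real.exp (-β * ε) * bellman M β q' x b ≤ bellman M β q x b := by
  rw [bellman, Finset.mul_sum]
  refine Finset.sum_le_sum fun x' _ => ?_
  rw [mul_left_comm, ← Real.exp_add]
  refine mul_le_mul_of_nonneg_left (Real.exp_le_exp.2 ?_) (M.p_nonneg _ _ _)
  have hmax : maxQ q x' ≤ maxQ q' x' + ε :=
    maxQ_le_iff.2 fun a => (h x' a).trans (by linarith [le_maxQ q' x' a])
  nlinarith

theorem bellman_le_of_exp_maxQ_le (M : MDP S A) {β : ℝ} {q q' : S → A → ℝ}
    (h : ∀ x, Real.exp (-β * maxQ q x) ≤ Real.exp (-β * maxQ q' x)) (x : S) (b : A) :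
    bellman M β q x b ≤ bellman M β q' x b := by
  refine Finset.sum_le_sum fun x' _ => mul_le_mul_of_nonneg_left ?_ (M.p_nonneg _ _ _)
  simp only [mul_add, Real.exp_add]
  exact mul_le_mul_of_nonneg_left (h x') (Real.exp_pos _).le

theorem exp_maxQ_le_mulVec {M : MDP S A} {β : ℝ} (hβ : 0 ≤ β) {q : S → A → ℝ}
    (hq : ∀ x b, Real.exp (-β * q x b) ≤ bellman M β q x b) (π : S → A) :
    (fun s => Real.exp (-β * maxQ q s)) ≤
      expMatrix M β π *ᵥ fun s => Real.exp (-β * maxQ q s) := by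
  intro s
  rw [← bellman_eq_mulVec]
  refine le_trans (Real.exp_le_exp.2 ?_) (hq s (π s))
  nlinarith [le_maxQ q s (π s)]

variable [DecidableEq S] {M : MDP S A} {β : ℝ}

theorem Transient.le_of_bellman_le (hM : Transient M) (hβ : 0 < β) {u l : S → A → ℝ}
    (hu₀ : ∀ b, u M.sink b = 0) (hl₀ : ∀ b, l M.sink b = 0)
    (hu : ∀ x b, bellman M β u x b ≤ Real.exp (-β * u x b))
    (hl : ∀ x b, Real.exp (-β * l x b) ≤ bellman M β l x b) (x : S) (b : A) : u x b ≤ l x b := by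
  obtain ⟨π, hπ⟩ := exists_greedy u
  have hmax := (hM.isAbsorbing_expMatrix β π).le_of_mulVec_le
    (f := fun s => Real.exp (-β * maxQ u s)) (g := fun s => Real.exp (-β * maxQ l s))
    (fun s => Real.exp_pos _)
    (fun s => by
      rw [← bellman_eq_mulVec]
      simpa only [maxQ_eq_of_greedy hπ] using hu s (π s))
    (exp_maxQ_le_mulVec hβ.le hl π) (by simp [maxQ_eq_zero hu₀, maxQ_eq_zero hl₀])
  have hexp : Real.exp (-β * l x b) ≤ Real.exp (-β * u x b) :=
    (hl x b).trans ((bellman_le_of_exp_maxQ_le M hmax x b).trans (hu x b))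
  nlinarith [Real.exp_le_exp.1 hexp]

/-- Solutions of the exponential Bellman equation, normalized to vanish at the sink (where the
equation leaves the value free). -/
structure IsBellmanSolution (M : MDP S A) (β : ℝ) (q : S → A → ℝ) : Prop where
  sink : ∀ b, q M.sink b = 0
  exp_eq : ∀ x b, Real.exp (-β * q x b) = bellman M β q x b

namespace IsBellmanSolution

variable {α : ℝ} {q : S → A → ℝ}

theorem hVal_le_hEst (hq : IsBellmanSolution M β q) (hM : Transient M) (hβ : 0 < β) (π : S → A) :
    hVal M α π β ≤ hEst M α β (some q) := by
  rw [hVal, hEst, EReal.coe_add]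
  exact add_le_add_left (hM.ermTotal_le_of_le_mulVec hβ (fun s => Real.exp_pos _)
    (by simp [maxQ_eq_zero hq.sink]) (exp_maxQ_le_mulVec hβ.le (fun x b => (hq.exp_eq x b).le) π)) _

theorem hVal_eq_hEst_of_greedy (hq : IsBellmanSolution M β q) (hM : Transient M) {π : S → A}
    (hπ : Greedy (some q) π) : hVal M α π β = hEst M α β (some q) := by
  rw [hVal, hEst, EReal.coe_add]
  congr 1
  refine hM.ermTotal_eq_of_mulVec_eq (fun s => Real.exp_pos _) (by simp [maxQ_eq_zero hq.sink]) ?_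
  ext s
  rw [← bellman_eq_mulVec, ← hq.exp_eq, maxQ_eq_of_greedy hπ]

theorem hEst_eq_hStar (hq : IsBellmanSolution M β q) (hM : Transient M) (hβ : 0 < β) :
    hEst M α β (some q) = hStar M α β := by
  obtain ⟨π, hπ⟩ := exists_greedy q
  refine le_antisymm ?_ (iSup_le (hq.hVal_le_hEst hM hβ))
  rw [← hq.hVal_eq_hEst_of_greedy hM hπ]
  exact le_iSup (fun π => hVal M α π β) π

end IsBellmanSolution

end Bellman

section StochasticApproximation

/-- Step sizes of a stochastic approximation scheme: nonnegative, vanishing, of infinite sum. -/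
structure IsStepSequence (a : ℕ → ℝ) : Prop where
  nonneg : ∀ i, 0 ≤ a i
  not_summable : ¬ Summable a
  tendsto_zero : Tendsto a atTop (𝓝 0)

namespace IsStepSequence

variable {a y d n : ℕ → ℝ}

theorem exists_lt_of_le_sub (ha : IsStepSequence a) {θ κ : ℝ} (hκ : 0 < κ) {i₀ : ℕ}
    (hy : ∀ i ≥ i₀, θ ≤ y i → y (i + 1) ≤ y i - κ * a i) : ∃ i ≥ i₀, y i < θ := by
  by_contra! hge
  have hle (k : ℕ) : y (k + i₀) ≤ y i₀ - κ * ∑ j ∈ Finset.range k, a (j + i₀) := by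
    induction k with
    | zero => simp
    | succ k ih =>
      have hstep := hy (k + i₀) (by omega) (hge _ (by omega))
      rw [Finset.sum_range_succ, mul_add, add_right_comm]
      linarith
  have hdiv := (not_summable_iff_tendsto_nat_atTop_of_nonneg fun j => ha.nonneg (j + i₀)).1
    ((summable_nat_add_iff i₀).not.2 ha.not_summable)
  obtain ⟨k, hk⟩ := ((hdiv.const_mul_atTop hκ).eventually_gt_atTop (y i₀ - θ)).exists
  linarith [hle k, hge (k + i₀) (by omega)]

theorem eventually_le_of_drift (ha : IsStepSequence a) {θ κ D : ℝ} (hκ : 0 < κ)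
    (hy : ∀ᶠ i in atTop, y (i + 1) = y i + a i * d i) (hD : ∀ᶠ i in atTop, d i ≤ D)
    (hd : ∀ᶠ i in atTop, θ ≤ y i → d i ≤ -κ) {ε : ℝ} (hε : 0 < ε) :
    ∀ᶠ i in atTop, y i ≤ θ + ε := by
  have hstep : ∀ᶠ i in atTop, a i * D < ε := by
    simpa using (ha.tendsto_zero.mul_const D).eventually_lt_const (by simpa using hε)
  obtain ⟨i₀, hi₀⟩ := eventually_atTop.1 (hy.and (hD.and (hd.and hstep)))
  have hdecr : ∀ i ≥ i₀, θ ≤ y i → y (i + 1) ≤ y i - κ * a i := fun i hi hθ => by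
    obtain ⟨hrec, -, hdrift, -⟩ := hi₀ i hi
    nlinarith [ha.nonneg i, hdrift hθ]
  have hstay : ∀ i ≥ i₀, y i ≤ θ + ε → y (i + 1) ≤ θ + ε := fun i hi hle => by
    rcases le_total θ (y i) with hθ | hθ
    · nlinarith [hdecr i hi hθ, ha.nonneg i]
    · obtain ⟨hrec, hdD, -, hsmall⟩ := hi₀ i hi
      nlinarith [mul_le_mul_of_nonneg_left hdD (ha.nonneg i)]
  obtain ⟨i₁, hi₁, hlt⟩ := ha.exists_lt_of_le_sub hκ hdecr
  refine eventually_atTop.2 ⟨i₁, fun i hi => ?_⟩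
  induction i, hi using Nat.le_induction with
  | base => linarith
  | succ i hi ih => exact hstay i (hi₁.trans hi) ih

/-- Subtracting the tail of the noise series turns the noisy recursion into a noise-free one. -/
theorem eventually_le_of_noisy_drift (ha : IsStepSequence a) {θ D N : ℝ}
    (hy : ∀ᶠ i in atTop, y (i + 1) = y i + a i * d i + n i) (hD : ∀ᶠ i in atTop, d i ≤ D)
    (hn : Tendsto (fun i => ∑ j ∈ Finset.range i, n j) atTop (𝓝 N))
    (hd : ∀ ε > 0, ∃ κ > 0, ∀ᶠ i in atTop, θ + ε ≤ y i → d i ≤ -κ) {ε : ℝ} (hε : 0 < ε) :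
    ∀ᶠ i in atTop, y i ≤ θ + ε := by
  obtain ⟨κ, hκ, hdκ⟩ := hd (ε / 4) (by positivity)
  set e : ℕ → ℝ := fun i => ∑ j ∈ Finset.range i, n j - N with he
  have he₀ : ∀ᶠ i in atTop, |e i| < ε / 4 := by
    simpa [he, Real.dist_eq] using Metric.tendsto_nhds.1 hn (ε / 4) (by positivity)
  have hrec : ∀ᶠ i in atTop, y (i + 1) - e (i + 1) = y i - e i + a i * d i := hy.mono fun i hi => by
    simp only [he, Finset.sum_range_succ, hi]
    ring
  have hdrift : ∀ᶠ i in atTop, θ + ε / 2 ≤ y i - e i → d i ≤ -κ := by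
    filter_upwards [hdκ, he₀] with i hi hei hθ
    exact hi (by linarith [(abs_lt.1 hei).1])
  filter_upwards [ha.eventually_le_of_drift hκ hrec hD hdrift (by positivity : 0 < ε / 4), he₀]
    with i hi hei
  linarith [(abs_lt.1 hei).2]

variable {g : ℕ → ℝ} {β θ N : ℝ}

theorem eventually_le_of_exp_drift (ha : IsStepSequence a) (hβ : 0 < β)
    (hy : ∀ᶠ i in atTop, y (i + 1) = y i + a i * (1 - Real.exp (β * y i) * g i) + n i)
    (hn : Tendsto (fun i => ∑ j ∈ Finset.range i, n j) atTop (𝓝 N))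
    (hg : ∀ ε > 0, ∀ᶠ i in atTop, Real.exp (-β * (θ + ε)) ≤ g i) {ε : ℝ} (hε : 0 < ε) :
    ∀ᶠ i in atTop, y i ≤ θ + ε := by
  refine ha.eventually_le_of_noisy_drift (D := 1) hy ?_ hn (fun ε hε => ?_) hε
  · filter_upwards [hg 1 one_pos] with i hi
    nlinarith [Real.exp_pos (β * y i), Real.exp_pos (-β * (θ + 1))]
  · refine ⟨Real.exp (β * (ε / 2)) - 1, by simpa using by positivity, ?_⟩
    filter_upwards [hg (ε / 2) (by positivity)] with i hi hθ
    have hexp : Real.exp (β * (ε / 2)) ≤ Real.exp (β * y i) * g i := by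
      calc Real.exp (β * (ε / 2))
          = Real.exp (β * (θ + ε)) * Real.exp (-β * (θ + ε / 2)) := by
            rw [← Real.exp_add]; ring_nf
        _ ≤ Real.exp (β * y i) * g i := by gcongr
    linarith

theorem eventually_ge_of_exp_drift (ha : IsStepSequence a) (hβ : 0 < β)
    (hy : ∀ᶠ i in atTop, y (i + 1) = y i + a i * (1 - Real.exp (β * y i) * g i) + n i)
    (hn : Tendsto (fun i => ∑ j ∈ Finset.range i, n j) atTop (𝓝 N)) {B : ℝ}
    (hB : ∀ᶠ i in atTop, y i ≤ B) (hg : ∀ ε > 0, ∀ᶠ i in atTop, g i ≤ Real.exp (-β * (θ - ε)))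
    {ε : ℝ} (hε : 0 < ε) : ∀ᶠ i in atTop, θ - ε ≤ y i := by
  suffices h : ∀ᶠ i in atTop, -y i ≤ -θ + ε from h.mono fun i hi => by linarith
  refine ha.eventually_le_of_noisy_drift (d := fun i => Real.exp (β * y i) * g i - 1)
    (D := Real.exp (β * B) * Real.exp (-β * (θ - 1))) (n := fun i => -n i) (N := -N)
    (hy.mono fun i hi => by rw [hi]; ring) ?_ (by simpa using hn.neg) (fun ε hε => ?_) hε
  · filter_upwards [hB, hg 1 one_pos] with i hBi hgi
    have hexp : Real.exp (β * y i) * g i ≤ Real.exp (β * B) * Real.exp (-β * (θ - 1)) :=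
      (mul_le_mul_of_nonneg_left hgi (Real.exp_pos _).le).trans (by gcongr)
    linarith
  · refine ⟨1 - Real.exp (-(β * (ε / 2))), by simpa using by positivity, ?_⟩
    filter_upwards [hg (ε / 2) (by positivity)] with i hi hθ
    have hexp : Real.exp (β * y i) * g i ≤ Real.exp (-(β * (ε / 2))) := by
      calc Real.exp (β * y i) * g i
          ≤ Real.exp (β * y i) * Real.exp (-β * (θ - ε / 2)) := by gcongr
        _ ≤ Real.exp (β * (θ - ε)) * Real.exp (-β * (θ - ε / 2)) := by
            gcongr
            linarith
        _ = Real.exp (-(β * (ε / 2))) := by rw [← Real.exp_add]; ring_nf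
    linarith

end IsStepSequence

variable {S A : Type*} [Fintype S] [Fintype A] [Nonempty A]

/-- Asynchronous ERM Q-learning in the form of a stochastic approximation scheme: away from the
sink, where the values vanish, `q` follows the exponential Bellman equation with step sizes `a` up
to the noise `n`, whose sum converges. -/
structure IsNoisyBellmanRecursion (M : MDP S A) (β : ℝ) (q a n : ℕ → S → A → ℝ) : Prop where
  sink : ∀ i b, q i M.sink b = 0
  step : ∀ x, x ≠ M.sink → ∀ b, IsStepSequence fun i => a i x b
  noise : ∀ x, x ≠ M.sink → ∀ b,
    ∃ N, Tendsto (fun i => ∑ j ∈ Finset.range i, n j x b) atTop (𝓝 N)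
  succ : ∀ x, x ≠ M.sink → ∀ b, ∀ᶠ i in atTop, q (i + 1) x b = q i x b +
    a i x b * (1 - Real.exp (β * q i x b) * bellman M β (q i) x b) + n i x b

theorem exp_neg_mul_log_bellman (M : MDP S A) {β : ℝ} (hβ : β ≠ 0) (q : S → A → ℝ) (x : S)
    (b : A) :
    Real.exp (-β * (-β⁻¹ * Real.log (bellman M β q x b))) = bellman M β q x b := by
  rw [← mul_assoc, neg_mul_neg, mul_inv_cancel₀ hβ, one_mul, Real.exp_log (bellman_pos M β q x b)]

namespace IsNoisyBellmanRecursion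

variable {M : MDP S A} {β : ℝ} {q a n : ℕ → S → A → ℝ}

theorem eventually_le_add (h : IsNoisyBellmanRecursion M β q a n) (hβ : 0 < β) {u : S → A → ℝ}
    (hu : ∀ ε > 0, ∀ᶠ i in atTop, ∀ x b, q i x b ≤ u x b + ε) {x : S} (hx : x ≠ M.sink) (b : A)
    {ε : ℝ} (hε : 0 < ε) :
    ∀ᶠ i in atTop, q i x b ≤ -β⁻¹ * Real.log (bellman M β u x b) + ε := by
  obtain ⟨N, hN⟩ := h.noise x hx b
  refine (h.step x hx b).eventually_le_of_exp_drift hβ (h.succ x hx b) hN (fun ε hε => ?_) hε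
  filter_upwards [hu ε hε] with i hi
  rw [mul_add, Real.exp_add, exp_neg_mul_log_bellman M hβ.ne', mul_comm]
  exact exp_mul_bellman_le M hβ.le hi x b

theorem eventually_sub_le (h : IsNoisyBellmanRecursion M β q a n) (hβ : 0 < β) {l : S → A → ℝ}
    (hl : ∀ ε > 0, ∀ᶠ i in atTop, ∀ x b, l x b ≤ q i x b + ε) {x : S} (hx : x ≠ M.sink) (b : A)
    {B : ℝ} (hB : ∀ᶠ i in atTop, q i x b ≤ B) {ε : ℝ} (hε : 0 < ε) :
    ∀ᶠ i in atTop, -β⁻¹ * Real.log (bellman M β l x b) - ε ≤ q i x b := by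
  obtain ⟨N, hN⟩ := h.noise x hx b
  refine (h.step x hx b).eventually_ge_of_exp_drift hβ (h.succ x hx b) hN hB (fun ε hε => ?_) hε
  filter_upwards [hl ε hε] with i hi
  have hle := exp_mul_bellman_le M hβ.le hi x b
  rwa [neg_mul, Real.exp_neg, inv_mul_le_iff₀ (Real.exp_pos _), mul_comm,
    ← exp_neg_mul_log_bellman M hβ.ne' l, ← Real.exp_add,
    show ∀ t, -β * t + β * ε = -β * (t - ε) by intro t; ring] at hle

theorem bellman_limsup_le (h : IsNoisyBellmanRecursion M β q a n) (hβ : 0 < β)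
    (hle : ∀ x b, IsBoundedUnder (· ≤ ·) atTop fun i => q i x b)
    (hge : ∀ x b, IsBoundedUnder (· ≥ ·) atTop fun i => q i x b) (x : S) (b : A) :
    bellman M β (fun x b => limsup (fun i => q i x b) atTop) x b ≤
      Real.exp (-β * limsup (fun i => q i x b) atTop) := by
  set u : S → A → ℝ := fun x b => limsup (fun i => q i x b) atTop with hu
  obtain rfl | hx := eq_or_ne x M.sink
  · rw [bellman_sink, maxQ_eq_zero fun b => by simp [hu, h.sink]]
    simp [h.sink]
  have hqu : ∀ ε > 0, ∀ᶠ i in atTop, ∀ x b, q i x b ≤ u x b + ε := fun ε hε => by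
    simp only [eventually_all]
    exact fun x b => (eventually_lt_of_limsup_lt (lt_add_of_pos_right (u x b) hε) (hle x b)).mono
      fun _ h => h.le
  have hub : u x b ≤ -β⁻¹ * Real.log (bellman M β u x b) := le_of_forall_pos_le_add fun ε hε =>
    limsup_le_of_le (hge x b).isCoboundedUnder_le (h.eventually_le_add hβ hqu hx b hε)
  rw [← exp_neg_mul_log_bellman M hβ.ne' u]
  exact Real.exp_le_exp.2 (mul_le_mul_of_nonpos_left hub (neg_nonpos.2 hβ.le))

theorem le_bellman_liminf (h : IsNoisyBellmanRecursion M β q a n) (hβ : 0 < β)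
    (hle : ∀ x b, IsBoundedUnder (· ≤ ·) atTop fun i => q i x b)
    (hge : ∀ x b, IsBoundedUnder (· ≥ ·) atTop fun i => q i x b) (x : S) (b : A) :
    Real.exp (-β * liminf (fun i => q i x b) atTop) ≤
      bellman M β (fun x b => liminf (fun i => q i x b) atTop) x b := by
  set l : S → A → ℝ := fun x b => liminf (fun i => q i x b) atTop with hl
  obtain rfl | hx := eq_or_ne x M.sink
  · rw [bellman_sink, maxQ_eq_zero fun b => by simp [hl, h.sink]]
    simp [h.sink]
  have hql : ∀ ε > 0, ∀ᶠ i in atTop, ∀ x b, l x b ≤ q i x b + ε := fun ε hε => by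
    simp only [eventually_all]
    exact fun x b => (eventually_lt_of_lt_liminf (sub_lt_self (l x b) hε) (hge x b)).mono
      fun _ h => (sub_lt_iff_lt_add.1 h).le
  obtain ⟨B, hB⟩ := (hle x b).eventually_le
  have hlb : -β⁻¹ * Real.log (bellman M β l x b) ≤ l x b := le_of_forall_sub_le fun ε hε =>
    le_liminf_of_le (hle x b).isCoboundedUnder_ge (h.eventually_sub_le hβ hql hx b hB hε)
  rw [← exp_neg_mul_log_bellman M hβ.ne' l]
  exact Real.exp_le_exp.2 (mul_le_mul_of_nonpos_left hlb (neg_nonpos.2 hβ.le))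

variable [DecidableEq S]

theorem exists_tendsto (h : IsNoisyBellmanRecursion M β q a n) (hM : Transient M) (hβ : 0 < β)
    (hbdd : ∀ x b, ∃ B, ∀ᶠ i in atTop, |q i x b| ≤ B) :
    ∃ q', Tendsto q atTop (𝓝 q') ∧ IsBellmanSolution M β q' := by
  have hle (x b) : IsBoundedUnder (· ≤ ·) atTop fun i => q i x b := by
    obtain ⟨B, hB⟩ := hbdd x b
    exact isBoundedUnder_of_eventually_le (hB.mono fun i hi => (abs_le.1 hi).2)
  have hge (x b) : IsBoundedUnder (· ≥ ·) atTop fun i => q i x b := by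
    obtain ⟨B, hB⟩ := hbdd x b
    exact isBoundedUnder_of_eventually_ge (hB.mono fun i hi => (abs_le.1 hi).1)
  have hu := h.bellman_limsup_le hβ hle hge
  have hl := h.le_bellman_liminf hβ hle hge
  have heq (x b) : liminf (fun i => q i x b) atTop = limsup (fun i => q i x b) atTop :=
    le_antisymm (liminf_le_limsup (hle x b) (hge x b)) <|
      hM.le_of_bellman_le hβ (fun b => by simp [h.sink]) (fun b => by simp [h.sink]) hu hl x b
  refine ⟨fun x b => limsup (fun i => q i x b) atTop, ?_, by simp [h.sink], fun x b => ?_⟩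
  · simp only [tendsto_pi_nhds]
    exact fun x b => tendsto_of_liminf_eq_limsup (heq x b) rfl (hle x b) (hge x b)
  · exact le_antisymm (by simpa only [heq] using hl x b) (hu x b)

end IsNoisyBellmanRecursion

section Boundedness

theorem exists_eventually_abs_le_of_eq_or_abs_le {y : ℕ → ℝ} {B : ℝ}
    (h : ∀ᶠ i in atTop, y (i + 1) = y i ∨ |y (i + 1)| ≤ B) : ∃ B', ∀ᶠ i in atTop, |y i| ≤ B' := by
  obtain ⟨i₀, hi₀⟩ := eventually_atTop.1 h
  refine ⟨max |y i₀| B, eventually_atTop.2 ⟨i₀, fun i hi => ?_⟩⟩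
  induction i, hi using Nat.le_induction with
  | base => exact le_max_left _ _
  | succ i hi ih =>
    rcases hi₀ i hi with heq | hle
    · rwa [heq]
    · exact le_max_of_le_right hle

variable [DecidableEq S] {M : MDP S A}

/-- The residual of a transition bounds the value of its origin by that of its target, and the
sink has value zero. -/
theorem Transient.exists_eventually_abs_le (hM : Transient M) {q : ℕ → S → A → ℝ} {C : ℝ}
    (hsink : ∀ i b, q i M.sink b = 0)
    (hupdate : ∀ x, x ≠ M.sink → ∀ b x', 0 < M.p x b x' → ∀ᶠ i in atTop,
      q (i + 1) x b = q i x b ∨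
        |tdResidual M (q i) x b x'| ≤ C ∧ |q (i + 1) x b - q i x b| ≤ C) (x : S) (b : A) :
    ∃ B, ∀ᶠ i in atTop, |q i x b| ≤ B := by
  induction x using hM.induction_on generalizing b with
  | sink => exact ⟨0, by simp [hsink]⟩
  | step x hx ih =>
    obtain ⟨x', hp, hx'⟩ := ih b
    obtain ⟨B, hB⟩ := exists_eventually_abs_maxQ_le hx'
    refine exists_eventually_abs_le_of_eq_or_abs_le (B := |M.r x b x'| + B + C + C) ?_
    filter_upwards [hB, hupdate x hx b x' hp] with i hBi hi
    refine hi.imp_right fun ⟨hres, hdiff⟩ => ?_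
    have hr := abs_le.1 (le_refl |M.r x b x'|)
    simp only [tdResidual, abs_le] at hBi hres hdiff ⊢
    constructor <;> linarith

end Boundedness

end StochasticApproximation

section Run

variable {S A : Type*} [Fintype S] [Fintype A] [Nonempty A]

open Classical in
/-- Step size that a sample at the pair `(s, a)` with step size `η` contributes to the update of
the pair `(x, b)`. -/
noncomputable def visitStep {S A : Type*} (η : ℝ) (s : S) (a : A) (x : S) (b : A) : ℝ :=
  if s = x ∧ a = b then η else 0

open Classical in
/-- Coefficient of the sampling noise `1{s' = x'} - p(x, b, x')` in the update of the pair `(x, b)`.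
It is cut off where the residual of `x'` would stop the run, which makes it square summable. -/
noncomputable def noiseCoeff (M : MDP S A) (β zmin zmax η : ℝ) (q : S → A → ℝ) (s : S) (a : A)
    (x : S) (b : A) (x' : S) : ℝ :=
  if tdResidual M q x b x' ∈ Set.Icc zmin zmax then
    visitStep η s a x b * Real.exp (-β * tdResidual M q x b x') else 0

theorem noiseCoeff_sq_le (M : MDP S A) {β : ℝ} (hβ : 0 ≤ β) (zmin zmax η : ℝ) (q : S → A → ℝ)
    (s : S) (a : A) (x : S) (b : A) (x' : S) :
    noiseCoeff M β zmin zmax η q s a x b x' ^ 2 ≤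
      Real.exp (-β * zmin) ^ 2 * visitStep η s a x b ^ 2 := by
  rw [noiseCoeff]
  split_ifs with hz
  · rw [mul_pow, mul_comm]
    have hexp : Real.exp (-β * tdResidual M q x b x') ≤ Real.exp (-β * zmin) :=
      Real.exp_le_exp.2 (by nlinarith [hz.1])
    gcongr
  · rw [zero_pow two_ne_zero]
    positivity

theorem isSome_qStep_iff {M : MDP S A} {β zmin zmax η : ℝ} {s : S} {a : A} {s' : S}
    {o : Option (S → A → ℝ)} : (qStep M β zmin zmax η s a s' o).isSome ↔
      o.isSome ∧ tdResidual M (o.getD 0) s a s' ∈ Set.Icc zmin zmax := by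
  cases o <;> simp [qStep, apply_ite Option.isSome]

theorem getD_qStep {M : MDP S A} {β zmin zmax η : ℝ} {s : S} {a : A} {s' : S}
    {o : Option (S → A → ℝ)} (h : (qStep M β zmin zmax η s a s' o).isSome) (x : S) (b : A) :
    (qStep M β zmin zmax η s a s' o).getD 0 x b = o.getD 0 x b -
      visitStep η s a x b * (Real.exp (-β * tdResidual M (o.getD 0) x b s') - 1) := by
  obtain ⟨q, rfl⟩ := Option.isSome_iff_exists.1 (isSome_qStep_iff.1 h).1
  have hz : zmin ≤ tdResidual M q s a s' ∧ tdResidual M q s a s' ≤ zmax :=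
    (isSome_qStep_iff.1 h).2
  rw [qStep, if_pos hz, visitStep]
  by_cases hv : s = x ∧ a = b
  · simp [hv]
  · simp [hv, eq_comm (a := x), eq_comm (a := b)]

theorem exp_mul_bellman (M : MDP S A) (β : ℝ) (q : S → A → ℝ) (x : S) (b : A) :
    Real.exp (β * q x b) * bellman M β q x b =
      ∑ x', M.p x b x' * Real.exp (-β * tdResidual M q x b x') := by
  rw [bellman, Finset.mul_sum]
  refine Finset.sum_congr rfl fun x' _ => ?_
  rw [mul_left_comm, ← Real.exp_add, tdResidual]
  ring_nf

open Classical in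
/-- A sample path on which a run of ERM Q-learning with the iterates `q` never stops and which has
the almost sure properties of the samples: the Robbins–Monro conditions, no transition of
probability zero, residual bounds that hold for every possible next state rather than for the
sampled one only, and convergence of the noise. -/
structure IsRegularRun (M : MDP S A) (β zmin zmax : ℝ) (η : ℕ → ℝ) (s : ℕ → S) (a : ℕ → A)
    (s' : ℕ → S) (q : ℕ → S → A → ℝ) : Prop where
  run : ∀ i, qIter M β zmin zmax η s a s' i = some (q i)
  step_nonneg : ∀ i, 0 ≤ η i
  not_summable_step : ∀ x, x ≠ M.sink → ∀ b,
    ¬ Summable fun i => visitStep (η i) (s i) (a i) x b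
  summable_step_sq : ∀ x, x ≠ M.sink → ∀ b,
    Summable fun i => visitStep (η i) (s i) (a i) x b ^ 2
  p_pos : ∀ i, 0 < M.p (s i) (a i) (s' i)
  residual_mem : ∀ x b x', 0 < M.p x b x' → ∀ᶠ i in atTop, s i = x ∧ a i = b →
    tdResidual M (q i) x b x' ∈ Set.Icc zmin zmax
  noise : ∀ x, x ≠ M.sink → ∀ b x', ∃ N, Tendsto (fun i => ∑ j ∈ Finset.range i,
    noiseCoeff M β zmin zmax (η j) (q j) (s j) (a j) x b x' *
      ((if s' j = x' then 1 else 0) - M.p (s j) (a j) x')) atTop (𝓝 N)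

namespace IsRegularRun

variable {M : MDP S A} {β zmin zmax : ℝ} {η : ℕ → ℝ} {s : ℕ → S} {a : ℕ → A} {s' : ℕ → S}
  {q : ℕ → S → A → ℝ}

theorem isSome_qStep (h : IsRegularRun M β zmin zmax η s a s' q) (i : ℕ) :
    (qStep M β zmin zmax (η i) (s i) (a i) (s' i) (some (q i))).isSome := by
  rw [← h.run i, ← qIter, h.run (i + 1), Option.isSome_some]

theorem tdResidual_mem (h : IsRegularRun M β zmin zmax η s a s' q) (i : ℕ) :
    tdResidual M (q i) (s i) (a i) (s' i) ∈ Set.Icc zmin zmax :=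
  (isSome_qStep_iff.1 (h.isSome_qStep i)).2

theorem succ_eq_sub (h : IsRegularRun M β zmin zmax η s a s' q) (i : ℕ) (x : S) (b : A) :
    q (i + 1) x b = q i x b -
      visitStep (η i) (s i) (a i) x b * (Real.exp (-β * tdResidual M (q i) x b (s' i)) - 1) := by
  have hq := getD_qStep (h.isSome_qStep i) x b
  rwa [← h.run i, ← qIter, h.run (i + 1), h.run i, Option.getD_some, Option.getD_some] at hq

theorem apply_sink (h : IsRegularRun M β zmin zmax η s a s' q) (i : ℕ) (b : A) :
    q i M.sink b = 0 := by
  classical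
  induction i generalizing b with
  | zero => rw [← Option.some.inj (h.run 0)]
  | succ i ih =>
    rw [h.succ_eq_sub, ih, visitStep]
    split_ifs with hv
    · have hs' : s' i = M.sink := by
        by_contra hne
        simpa [hv.1, p_sink_eq_single, hne] using h.p_pos i
      simp [tdResidual, hs', M.r_sink, maxQ_eq_zero ih, ih]
    · simp

theorem isStepSequence (h : IsRegularRun M β zmin zmax η s a s' q) {x : S} (hx : x ≠ M.sink)
    (b : A) : IsStepSequence fun i => visitStep (η i) (s i) (a i) x b where
  nonneg i := by
    rw [visitStep]
    split_ifs
    exacts [h.step_nonneg i, le_rfl]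
  not_summable := h.not_summable_step x hx b
  tendsto_zero := by
    rw [tendsto_zero_iff_abs_tendsto_zero]
    simpa [Real.sqrt_sq_eq_abs, Function.comp_def] using
      (h.summable_step_sq x hx b).tendsto_atTop_zero.sqrt

theorem exists_eventually_abs_le [DecidableEq S] (h : IsRegularRun M β zmin zmax η s a s' q)
    (hM : Transient M) (hβ : 0 ≤ β) (x : S) (b : A) : ∃ B, ∀ᶠ i in atTop, |q i x b| ≤ B := by
  refine hM.exists_eventually_abs_le (C := max |zmin| |zmax| + (Real.exp (-β * zmin) + 1))
    h.apply_sink (fun x hx b x' hp => ?_) x b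
  have hstep := h.isStepSequence hx b
  filter_upwards [h.residual_mem x b x' hp, hstep.tendsto_zero.eventually_le_const one_pos]
    with i hres hle
  by_cases hv : s i = x ∧ a i = b
  · refine .inr ⟨(abs_le_max_abs_abs (hres hv).1 (hres hv).2).trans
      (le_add_of_nonneg_right (by positivity)), ?_⟩
    have hz := h.tdResidual_mem i
    rw [hv.1, hv.2] at hz
    have hexp : |Real.exp (-β * tdResidual M (q i) x b (s' i)) - 1| ≤ Real.exp (-β * zmin) + 1 := by
      refine (abs_sub _ _).trans ?_
      rw [abs_one, Real.abs_exp]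
      gcongr ?_ + 1
      exact Real.exp_le_exp.2 (by nlinarith [hz.1])
    rw [h.succ_eq_sub, sub_sub_cancel_left, abs_neg, abs_mul, abs_of_nonneg (hstep.nonneg i)]
    nlinarith [abs_nonneg (Real.exp (-β * tdResidual M (q i) x b (s' i)) - 1),
      hstep.nonneg i, le_max_of_le_left (b := |zmin|) (c := |zmax|) (abs_nonneg zmin)]
  · exact .inl (by simp [h.succ_eq_sub, visitStep, hv])

theorem eventually_noiseCoeff_eq (h : IsRegularRun M β zmin zmax η s a s' q) (x : S) (b : A) :
    ∀ᶠ i in atTop, ∀ x', 0 < M.p x b x' →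
      noiseCoeff M β zmin zmax (η i) (q i) (s i) (a i) x b x' =
        visitStep (η i) (s i) (a i) x b * Real.exp (-β * tdResidual M (q i) x b x') := by
  refine eventually_all.2 fun x' => ?_
  simp only [eventually_imp_distrib_left]
  intro hp
  filter_upwards [h.residual_mem x b x' hp] with i hi
  by_cases hv : s i = x ∧ a i = b
  · rw [noiseCoeff, if_pos (hi hv)]
  · simp [noiseCoeff, visitStep, hv]

open Classical in
theorem eventually_succ_eq (h : IsRegularRun M β zmin zmax η s a s' q) (x : S) (b : A) :
    ∀ᶠ i in atTop, q (i + 1) x b = q i x b + visitStep (η i) (s i) (a i) x b *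
        (1 - Real.exp (β * q i x b) * bellman M β (q i) x b) +
      -∑ x', noiseCoeff M β zmin zmax (η i) (q i) (s i) (a i) x b x' *
        ((if s' i = x' then 1 else 0) - M.p (s i) (a i) x') := by
  filter_upwards [h.eventually_noiseCoeff_eq x b] with i hi
  rw [h.succ_eq_sub]
  by_cases hv : s i = x ∧ a i = b
  · have hp := h.p_pos i
    rw [hv.1, hv.2] at hp hi ⊢
    have hsample : ∑ x', noiseCoeff M β zmin zmax (η i) (q i) x b x b x' *
        (if s' i = x' then 1 else 0) =
        visitStep (η i) x b x b * Real.exp (-β * tdResidual M (q i) x b (s' i)) := by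
      simp [hi _ hp]
    have hmean : ∑ x', noiseCoeff M β zmin zmax (η i) (q i) x b x b x' * M.p x b x' =
        visitStep (η i) x b x b * (Real.exp (β * q i x b) * bellman M β (q i) x b) := by
      rw [exp_mul_bellman, Finset.mul_sum]
      refine Finset.sum_congr rfl fun x' _ => ?_
      obtain hp' | hp' := (M.p_nonneg x b x').eq_or_lt
      · simp [← hp']
      · rw [hi x' hp']
        ring
    simp only [mul_sub, Finset.sum_sub_distrib, hsample, hmean]
    ring
  · simp [noiseCoeff, visitStep, hv]

open Classical in
theorem isNoisyBellmanRecursion (h : IsRegularRun M β zmin zmax η s a s' q) :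
    IsNoisyBellmanRecursion M β q (fun i => visitStep (η i) (s i) (a i)) fun i x b =>
      -∑ x', noiseCoeff M β zmin zmax (η i) (q i) (s i) (a i) x b x' *
        ((if s' i = x' then 1 else 0) - M.p (s i) (a i) x') where
  sink := h.apply_sink
  step _ hx b := h.isStepSequence hx b
  noise x hx b := by
    choose N hN using h.noise x hx b
    refine ⟨-∑ x', N x', ?_⟩
    simp only [Finset.sum_neg_distrib, Finset.sum_comm (s := Finset.range _)]
    exact (tendsto_finsetSum _ fun x' _ => hN x').neg
  succ x _ b := h.eventually_succ_eq x b

theorem exists_tendsto [DecidableEq S] (h : IsRegularRun M β zmin zmax η s a s' q)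
    (hM : Transient M) (hβ : 0 < β) : ∃ q', Tendsto q atTop (𝓝 q') ∧ IsBellmanSolution M β q' :=
  h.isNoisyBellmanRecursion.exists_tendsto hM hβ (h.exists_eventually_abs_le hM hβ.le)

end IsRegularRun

end Run

section MartingaleTransform

variable {Ω : Type*} {mΩ : MeasurableSpace Ω} {P : Measure Ω} {ℱ : Filtration ℕ mΩ}
  {c ξ : ℕ → Ω → ℝ}

/-- Martingale differences bounded by `1`. The index is shifted as for a sequence of samples:
`ξ i` is revealed at time `i + 1` and centered given the past up to time `i`. -/
structure IsBoundedMartingaleDifference (ℱ : Filtration ℕ mΩ) (P : Measure Ω)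
    (ξ : ℕ → Ω → ℝ) : Prop where
  measurable : ∀ i, Measurable[ℱ (i + 1)] (ξ i)
  abs_le_one : ∀ i ω, |ξ i ω| ≤ 1
  condExp_eq_zero : ∀ i, P[ξ i | ℱ i] =ᵐ[P] 0

/-- The discrete stochastic integral of the coefficients `c` against the differences `ξ`. -/
def martingaleTransform (c ξ : ℕ → Ω → ℝ) (n : ℕ) (ω : Ω) : ℝ :=
  ∑ j ∈ Finset.range n, c j ω * ξ j ω

theorem martingaleTransform_succ (c ξ : ℕ → Ω → ℝ) (n : ℕ) :
    martingaleTransform c ξ (n + 1) = martingaleTransform c ξ n + c n * ξ n := by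
  ext ω
  simp [martingaleTransform, Finset.sum_range_succ]

namespace IsBoundedMartingaleDifference

theorem memLp_top (h : IsBoundedMartingaleDifference ℱ P ξ) (i : ℕ) : MemLp (ξ i) ⊤ P :=
  memLp_top_of_bound ((h.measurable i).mono (ℱ.le _) le_rfl).aestronglyMeasurable 1
    (Eventually.of_forall (h.abs_le_one i))

theorem memLp_top_martingaleTransform (h : IsBoundedMartingaleDifference ℱ P ξ)
    (hc : ∀ i, MemLp (c i) ⊤ P) (n : ℕ) : MemLp (martingaleTransform c ξ n) ⊤ P := by
  induction n with
  | zero => exact MemLp.zero'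
  | succ n ih =>
    rw [martingaleTransform_succ]
    exact ih.add ((h.memLp_top n).mul (hc n))

theorem measurable_martingaleTransform (h : IsBoundedMartingaleDifference ℱ P ξ)
    (hc : ∀ i, Measurable[ℱ i] (c i)) (n : ℕ) : Measurable[ℱ n] (martingaleTransform c ξ n) :=
  Finset.measurable_fun_sum _ fun j hj =>
    have hj : j < n := Finset.mem_range.1 hj
    ((hc j).mono (ℱ.mono hj.le) le_rfl).mul ((h.measurable j).mono (ℱ.mono hj) le_rfl)

variable [IsFiniteMeasure P]

theorem condExp_mul_eq_zero (h : IsBoundedMartingaleDifference ℱ P ξ) {i : ℕ} {f : Ω → ℝ}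
    (hf : Measurable[ℱ i] f) (hf' : MemLp f ⊤ P) : P[f * ξ i | ℱ i] =ᵐ[P] 0 := by
  refine (condExp_mul_of_stronglyMeasurable_left hf.stronglyMeasurable
    (((h.memLp_top i).mul hf').integrable le_top) ((h.memLp_top i).integrable le_top)).trans ?_
  filter_upwards [h.condExp_eq_zero i] with ω hω
  simp [hω]

theorem integral_mul_eq_zero (h : IsBoundedMartingaleDifference ℱ P ξ) {i : ℕ} {f : Ω → ℝ}
    (hf : Measurable[ℱ i] f) (hf' : MemLp f ⊤ P) : ∫ ω, (f * ξ i) ω ∂P = 0 := by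
  rw [← integral_condExp (ℱ.le i), integral_congr_ae (h.condExp_mul_eq_zero hf hf')]
  simp

theorem martingale_martingaleTransform (h : IsBoundedMartingaleDifference ℱ P ξ)
    (hc : ∀ i, Measurable[ℱ i] (c i)) (hc' : ∀ i, MemLp (c i) ⊤ P) :
    Martingale (martingaleTransform c ξ) ℱ P :=
  martingale_of_condExp_sub_eq_zero_nat
    (fun n => (h.measurable_martingaleTransform hc n).stronglyMeasurable)
    (fun n => (h.memLp_top_martingaleTransform hc' n).integrable le_top) fun i => by
      rw [martingaleTransform_succ, add_sub_cancel_left]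
      exact h.condExp_mul_eq_zero (hc i) (hc' i)

theorem integral_martingaleTransform_sq_le (h : IsBoundedMartingaleDifference ℱ P ξ)
    (hc : ∀ i, Measurable[ℱ i] (c i)) (hc' : ∀ i, MemLp (c i) ⊤ P) (n : ℕ) :
    ∫ ω, martingaleTransform c ξ n ω ^ 2 ∂P ≤ ∑ j ∈ Finset.range n, ∫ ω, c j ω ^ 2 ∂P := by
  induction n with
  | zero => simp [martingaleTransform]
  | succ n ih =>
    set X := martingaleTransform c ξ
    have hX := h.memLp_top_martingaleTransform hc'
    have hsq : ∀ {f : Ω → ℝ}, MemLp f ⊤ P → Integrable (fun ω => f ω ^ 2) P :=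
      fun hf => (hf.mono_exponent le_top).integrable_sq
    have hXc : MemLp (X n * c n) ⊤ P := (hc' n).mul (hX n)
    have hcross : Integrable (X n * c n * ξ n) P :=
      ((h.memLp_top n).mul hXc).integrable le_top
    have hzero : ∫ ω, (X n * c n * ξ n) ω ∂P = 0 :=
      h.integral_mul_eq_zero ((h.measurable_martingaleTransform hc n).mul (hc n)) hXc
    have hle : ∀ ω, X (n + 1) ω ^ 2 ≤ X n ω ^ 2 + 2 * (X n * c n * ξ n) ω + c n ω ^ 2 := by
      intro ω
      have hξ : c n ω ^ 2 * ξ n ω ^ 2 ≤ c n ω ^ 2 :=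
        mul_le_of_le_one_right (sq_nonneg _) ((sq_le_one_iff_abs_le_one _).2 (h.abs_le_one n ω))
      simp only [X, martingaleTransform_succ, Pi.add_apply, Pi.mul_apply]
      linear_combination hξ
    calc ∫ ω, X (n + 1) ω ^ 2 ∂P
        ≤ ∫ ω, X n ω ^ 2 + 2 * (X n * c n * ξ n) ω + c n ω ^ 2 ∂P :=
          integral_mono (hsq (hX _)) (((hsq (hX n)).add (hcross.const_mul 2)).add (hsq (hc' n)))
            hle
      _ = ∫ ω, X n ω ^ 2 ∂P + 2 * ∫ ω, (X n * c n * ξ n) ω ∂P + ∫ ω, c n ω ^ 2 ∂P := by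
          rw [← integral_const_mul, ← integral_add (hsq (hX n)) (hcross.const_mul 2)]
          exact integral_add ((hsq (hX n)).add (hcross.const_mul 2)) (hsq (hc' n))
      _ ≤ ∑ j ∈ Finset.range (n + 1), ∫ ω, c j ω ^ 2 ∂P := by
          rw [hzero, mul_zero, add_zero, Finset.sum_range_succ]
          gcongr

end IsBoundedMartingaleDifference

theorem ae_exists_tendsto_of_integral_sq_le [IsFiniteMeasure P] {X : ℕ → Ω → ℝ}
    (hX : Martingale X ℱ P) (hX' : ∀ n, MemLp (X n) 2 P) {N : ℝ}
    (hN : ∀ n, ∫ ω, X n ω ^ 2 ∂P ≤ N) : ∀ᵐ ω ∂P, ∃ l, Tendsto (X · ω) atTop (𝓝 l) := by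
  refine hX.submartingale.exists_ae_tendsto_of_bdd (R := (P.real Set.univ + N).toNNReal)
    fun n => ?_
  rw [eLpNorm_one_eq_lintegral_enorm,
    ← ofReal_integral_norm_eq_lintegral_enorm (hX.integrable n)]
  refine ENNReal.ofReal_le_ofReal ?_
  calc ∫ ω, ‖X n ω‖ ∂P ≤ ∫ ω, 1 + X n ω ^ 2 ∂P := by
        refine integral_mono (hX.integrable n).norm
          ((integrable_const 1).add (hX' n).integrable_sq) fun ω => ?_
        rw [Real.norm_eq_abs, ← sq_abs]
        nlinarith [sq_nonneg (|X n ω| - 1), abs_nonneg (X n ω)]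
    _ = P.real Set.univ + ∫ ω, X n ω ^ 2 ∂P := by
        rw [integral_add (integrable_const 1) (hX' n).integrable_sq]
        simp
    _ ≤ P.real Set.univ + N := by
        gcongr
        exact hN n

open Classical in
/-- The coefficients `c`, switched off as soon as their sum of squares exceeds `N`. The decision
at time `i` uses `c i` itself, so that it is predictable if `c` is. -/
noncomputable def cutoffCoeff (c : ℕ → Ω → ℝ) (N : ℝ) (i : ℕ) (ω : Ω) : ℝ :=
  if ∑ j ∈ Finset.range (i + 1), c j ω ^ 2 ≤ N then c i ω else 0

theorem measurable_cutoffCoeff (hc : ∀ i, Measurable[ℱ i] (c i)) (N : ℝ) (i : ℕ) :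
    Measurable[ℱ i] (cutoffCoeff c N i) := by
  have hsum : Measurable[ℱ i] fun ω => ∑ j ∈ Finset.range (i + 1), c j ω ^ 2 :=
    Finset.measurable_fun_sum _ fun j hj =>
      ((hc j).mono (ℱ.mono (Nat.lt_succ_iff.1 (Finset.mem_range.1 hj))) le_rfl).pow_const 2
  exact Measurable.ite (hsum measurableSet_Iic) (hc i) measurable_const

theorem sum_cutoffCoeff_sq_le (c : ℕ → Ω → ℝ) {N : ℝ} (hN : 0 ≤ N) (n : ℕ) (ω : Ω) :
    ∑ j ∈ Finset.range n, cutoffCoeff c N j ω ^ 2 ≤ N := by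
  induction n with
  | zero => simpa using hN
  | succ n ih =>
    by_cases h : ∑ j ∈ Finset.range (n + 1), c j ω ^ 2 ≤ N
    · refine (Finset.sum_le_sum fun j _ => ?_).trans h
      rw [cutoffCoeff]
      split_ifs
      exacts [le_rfl, (zero_pow two_ne_zero).trans_le (sq_nonneg _)]
    · rwa [Finset.sum_range_succ, cutoffCoeff, if_neg h, zero_pow two_ne_zero, add_zero]

theorem cutoffCoeff_eq_of_tsum_le {N : ℝ} {ω : Ω} (hc : Summable fun i => c i ω ^ 2)
    (hN : ∑' i, c i ω ^ 2 ≤ N) (i : ℕ) : cutoffCoeff c N i ω = c i ω :=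
  if_pos ((hc.sum_le_tsum _ fun _ _ => sq_nonneg _).trans hN)

theorem memLp_top_cutoffCoeff (hc : ∀ i, Measurable[ℱ i] (c i)) {N : ℝ} (hN : 0 ≤ N) (i : ℕ) :
    MemLp (cutoffCoeff c N i) ⊤ P := by
  refine memLp_top_of_bound
    ((measurable_cutoffCoeff hc N i).mono (ℱ.le i) le_rfl).aestronglyMeasurable √N
    (Eventually.of_forall fun ω => Real.abs_le_sqrt ?_)
  exact (Finset.single_le_sum (f := fun j => cutoffCoeff c N j ω ^ 2)
    (fun j _ => sq_nonneg _) (Finset.self_mem_range_succ i)).trans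
      (sum_cutoffCoeff_sq_le c hN _ ω)

namespace IsBoundedMartingaleDifference

variable [IsFiniteMeasure P]

theorem ae_exists_tendsto_cutoffCoeff (h : IsBoundedMartingaleDifference ℱ P ξ)
    (hc : ∀ i, Measurable[ℱ i] (c i)) {N : ℝ} (hN : 0 ≤ N) :
    ∀ᵐ ω ∂P, ∃ l, Tendsto (martingaleTransform (cutoffCoeff c N) ξ · ω) atTop (𝓝 l) := by
  have hm := measurable_cutoffCoeff hc N
  have hL := memLp_top_cutoffCoeff (P := P) hc hN
  have hint : ∀ i, Integrable (fun ω => cutoffCoeff c N i ω ^ 2) P := fun i =>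
    ((hL i).mono_exponent le_top).integrable_sq
  refine ae_exists_tendsto_of_integral_sq_le (N := ∫ _, N ∂P)
    (h.martingale_martingaleTransform hm hL)
    (fun n => (h.memLp_top_martingaleTransform hL n).mono_exponent le_top) fun n => ?_
  calc ∫ ω, martingaleTransform (cutoffCoeff c N) ξ n ω ^ 2 ∂P
      ≤ ∑ j ∈ Finset.range n, ∫ ω, cutoffCoeff c N j ω ^ 2 ∂P :=
        h.integral_martingaleTransform_sq_le hm hL n
    _ = ∫ ω, ∑ j ∈ Finset.range n, cutoffCoeff c N j ω ^ 2 ∂P :=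
        (integral_finsetSum _ fun i _ => hint i).symm
    _ ≤ ∫ _, N ∂P :=
        integral_mono (integrable_finsetSum _ fun i _ => hint i) (integrable_const N)
          (sum_cutoffCoeff_sq_le c hN n)

theorem ae_exists_tendsto (h : IsBoundedMartingaleDifference ℱ P ξ)
    (hc : ∀ i, Measurable[ℱ i] (c i)) (hsum : ∀ᵐ ω ∂P, Summable fun i => c i ω ^ 2) :
    ∀ᵐ ω ∂P, ∃ l, Tendsto (martingaleTransform c ξ · ω) atTop (𝓝 l) := by
  filter_upwards [ae_all_iff.2 fun N : ℕ => h.ae_exists_tendsto_cutoffCoeff hc N.cast_nonneg,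
    hsum] with ω hcut hω
  obtain ⟨N, hN⟩ := exists_nat_ge (∑' i, c i ω ^ 2)
  simpa only [martingaleTransform, cutoffCoeff_eq_of_tsum_le hω hN] using hcut N

end IsBoundedMartingaleDifference

end MartingaleTransform

section CondExp

variable {Ω : Type*} {mΩ : MeasurableSpace Ω} {P : Measure Ω} [IsFiniteMeasure P]

theorem ae_imp_notMem_of_condExp_indicator_eq_zero {m : MeasurableSpace Ω} (hm : m ≤ mΩ)
    {D E : Set Ω} (hD : MeasurableSet[m] D) (hE : MeasurableSet[mΩ] E)
    (h : ∀ᵐ ω ∂P, ω ∈ D → (P[E.indicator (fun _ => (1 : ℝ)) | m]) ω = 0) :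
    ∀ᵐ ω ∂P, ω ∈ D → ω ∉ E := by
  have hint : Integrable (E.indicator fun _ => (1 : ℝ)) P := (integrable_const 1).indicator hE
  have hzero : P[D.indicator (E.indicator fun _ => (1 : ℝ)) | m] =ᵐ[P] 0 := by
    refine (condExp_indicator hint hD).trans ?_
    filter_upwards [h] with ω hω
    by_cases hωD : ω ∈ D <;> simp [hωD, hω]
  have hDE : ∫ ω, D.indicator (E.indicator fun _ => (1 : ℝ)) ω ∂P = 0 := by
    rw [← integral_condExp hm, integral_congr_ae hzero]
    simp
  rw [Set.indicator_indicator, integral_indicator_const _ ((hm _ hD).inter hE), smul_eq_mul,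
    mul_one, measureReal_eq_zero_iff] at hDE
  filter_upwards [measure_eq_zero_iff_ae_notMem.1 hDE] with ω hω hωD hωE
  exact hω ⟨hωD, hωE⟩

/-- A consequence of Lévy's conditional Borel–Cantelli lemma for the events `D i ∩ E i`. -/
theorem ae_eventually_notMem_of_le_condExp {ℱ : Filtration ℕ mΩ} {D E : ℕ → Set Ω}
    (hD : ∀ i, MeasurableSet[ℱ i] (D i)) (hE : ∀ i, MeasurableSet[ℱ (i + 1)] (E i))
    {ε : ℝ} (hε : 0 < ε)
    (hle : ∀ i, ∀ᵐ ω ∂P, ω ∈ D i → ε ≤ (P[(E i).indicator (fun _ => (1 : ℝ)) | ℱ i]) ω) :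
    ∀ᵐ ω ∂P, (∀ i, ω ∈ D i → ω ∉ E i) → ∀ᶠ i in atTop, ω ∉ D i := by
  set F : ℕ → Set Ω := fun n => Nat.casesOn n ∅ fun i => D i ∩ E i
  have hF : ∀ n, MeasurableSet[ℱ n] (F n)
    | 0 => @MeasurableSet.empty _ (ℱ 0)
    | i + 1 => (ℱ.mono i.le_succ _ (hD i)).inter (hE i)
  have hcond : ∀ i, P[(F (i + 1)).indicator (1 : Ω → ℝ) | ℱ i] =ᵐ[P]
      (D i).indicator (P[(E i).indicator (fun _ => (1 : ℝ)) | ℱ i]) := fun i => by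
    have hF' : (F (i + 1)).indicator (1 : Ω → ℝ) =
        (D i).indicator ((E i).indicator fun _ => (1 : ℝ)) := by
      rw [Set.indicator_indicator]
      rfl
    rw [hF']
    exact condExp_indicator ((integrable_const 1).indicator (ℱ.le _ _ (hE i))) (hD i)
  filter_upwards [ae_mem_limsup_atTop_iff P hF, ae_all_iff.2 hcond, ae_all_iff.2 hle]
    with ω hlim hcond hle hDE
  by_contra hcon
  have hnot : ω ∉ limsup F atTop := by
    rw [mem_limsup_iff_frequently_mem]
    refine not_frequently.2 (Eventually.of_forall fun n hn => ?_)
    cases n with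
    | zero => exact hn
    | succ i => exact hDE i hn.1 hn.2
  refine hnot (hlim.2 ?_)
  simp only [hcond]
  refine (not_summable_iff_tendsto_nat_atTop_of_nonneg fun i =>
    Set.indicator_apply_nonneg fun hi => hε.le.trans (hle i hi)).1 fun hs => hcon ?_
  filter_upwards [hs.tendsto_atTop_zero.eventually_lt_const hε] with i hi hmem
  rw [Set.indicator_of_mem hmem] at hi
  exact (hle i hmem).not_gt hi

end CondExp

section History

variable {S A Ω : Type*} {η : ℕ → Ω → ℝ} {s : ℕ → Ω → S} {a : ℕ → Ω → A} {s' : ℕ → Ω → S}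

theorem measurable_apply_of_countable {m : MeasurableSpace Ω} {X Y : Type*} [MeasurableSpace Y]
    [Countable X] {D : Ω → X} (hD : Measurable[m, ⊤] D) {f : X → Ω → Y}
    (hf : ∀ d, Measurable[m] (f d)) : Measurable[m] fun ω => f (D ω) ω := by
  let _ : MeasurableSpace X := ⊤
  exact (measurable_from_prod_countable_right (f := fun z : X × Ω => f z.1 z.2) hf).comp
    (hD.prodMk measurable_id)

theorem measurable_step_history (i : ℕ) : Measurable[history η s a s' i] (η i) :=
  measurable_iff_comap_le.2 (le_sup_left.trans (le_sup_left.trans le_sup_left))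

theorem measurable_state_history (i : ℕ) : Measurable[history η s a s' i, ⊤] (s i) :=
  measurable_iff_comap_le.2 (le_sup_right.trans (le_sup_left.trans le_sup_left))

theorem measurable_action_history (i : ℕ) : Measurable[history η s a s' i, ⊤] (a i) :=
  measurable_iff_comap_le.2 (le_sup_right.trans le_sup_left)

theorem past_le_history {i l : ℕ} (h : l < i) :
    MeasurableSpace.comap (η l) inferInstance ⊔ MeasurableSpace.comap (s l) ⊤ ⊔
      MeasurableSpace.comap (a l) ⊤ ⊔ MeasurableSpace.comap (s' l) ⊤ ≤ history η s a s' i :=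
  le_sup_of_le_right (le_iSup (fun l : Fin i => MeasurableSpace.comap (η l) inferInstance ⊔
    MeasurableSpace.comap (s l) ⊤ ⊔ MeasurableSpace.comap (a l) ⊤ ⊔
    MeasurableSpace.comap (s' l) ⊤) ⟨l, h⟩)

theorem measurable_next_history (i : ℕ) : Measurable[history η s a s' (i + 1), ⊤] (s' i) :=
  measurable_iff_comap_le.2 (le_sup_right.trans (past_le_history i.lt_succ_self))

theorem history_mono : Monotone (history η s a s') := by
  intro i j hij
  rcases hij.eq_or_lt with rfl | hij
  · exact le_rfl
  · exact sup_le (le_sup_left.trans (past_le_history hij))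
      (iSup_le fun l => past_le_history (l.2.trans hij))

theorem measurableSet_next_history (i : ℕ) (x : S) :
    MeasurableSet[history η s a s' (i + 1)] {ω | s' i ω = x} :=
  measurable_next_history i (t := {x}) trivial

theorem measurableSet_visit (i : ℕ) (x : S) (b : A) :
    MeasurableSet[history η s a s' i] {ω | s i ω = x ∧ a i ω = b} :=
  MeasurableSet.inter (measurable_state_history i (t := {x}) trivial)
    (measurable_action_history i (t := {b}) trivial)

theorem measurable_visitStep (i : ℕ) (x : S) (b : A) :
    Measurable[history η s a s' i] fun ω => visitStep (η i ω) (s i ω) (a i ω) x b :=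
  Measurable.ite (measurableSet_visit i x b) (measurable_step_history i) measurable_const

theorem measurable_apply_sample [Countable S] [Countable A] {f : S → A → S → Ω → ℝ} (i : ℕ)
    (hf : ∀ x b x', Measurable[history η s a s' (i + 1)] (f x b x')) :
    Measurable[history η s a s' (i + 1)] fun ω => f (s i ω) (a i ω) (s' i ω) ω :=
  have hle : history η s a s' i ≤ history η s a s' (i + 1) := history_mono i.le_succ
  measurable_apply_of_countable (f := fun x ω => f x (a i ω) (s' i ω) ω)
    ((measurable_state_history i).mono hle le_rfl) fun x =>
  measurable_apply_of_countable (f := fun b ω => f x b (s' i ω) ω)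
    ((measurable_action_history i).mono hle le_rfl) fun b =>
  measurable_apply_of_countable (measurable_next_history i) (hf x b)

theorem measurable_transition [Fintype S] [Countable A] (M : MDP S A) (i : ℕ) (x : S) :
    Measurable[history η s a s' i] fun ω => M.p (s i ω) (a i ω) x :=
  measurable_apply_of_countable (f := fun y ω => M.p y (a i ω) x) (measurable_state_history i)
    fun y => measurable_apply_of_countable (f := fun b _ => M.p y b x)
      (measurable_action_history i) fun _ => measurable_const

end History

namespace IsSampleStream

variable {S A Ω : Type*} [mΩ : MeasurableSpace Ω] [Fintype S] {M : MDP S A} {P : Measure Ω}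
  {η : ℕ → Ω → ℝ} {s : ℕ → Ω → S} {a : ℕ → Ω → A} {s' : ℕ → Ω → S}

theorem history_le (h : IsSampleStream M P η s a s') (i : ℕ) : history η s a s' i ≤ mΩ := by
  refine sup_le (sup_le (sup_le ?_ ?_) ?_)
    (iSup_le fun l => sup_le (sup_le (sup_le ?_ ?_) ?_) ?_)
  exacts [(h.measurable_step _).comap_le, (h.measurable_state _).comap_le,
    (h.measurable_action _).comap_le, (h.measurable_step _).comap_le,
    (h.measurable_state _).comap_le, (h.measurable_action _).comap_le,
    (h.measurable_next _).comap_le]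

/-- The filtration of the histories of a sample stream. -/
def filtration (h : IsSampleStream M P η s a s') : Filtration ℕ mΩ where
  seq := history η s a s'
  mono' := history_mono
  le' := h.history_le

theorem measurableSet_next_eq (h : IsSampleStream M P η s a s') (i : ℕ) (x : S) :
    MeasurableSet {ω | s' i ω = x} :=
  h.measurable_next i (t := {x}) trivial

variable [IsFiniteMeasure P]

theorem ae_eventually_notMem (h : IsSampleStream M P η s a s') {x : S} {b : A} {x' : S}
    (hp : 0 < M.p x b x') {D : ℕ → Set Ω} (hD : ∀ i, MeasurableSet[history η s a s' i] (D i))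
    (hDsub : ∀ i, ∀ ω ∈ D i, s i ω = x ∧ a i ω = b) :
    ∀ᵐ ω ∂P, (∀ i, ω ∈ D i → s' i ω ≠ x') → ∀ᶠ i in atTop, ω ∉ D i := by
  refine ae_eventually_notMem_of_le_condExp (ℱ := h.filtration)
    (E := fun i => {ω | s' i ω = x'}) hD (measurableSet_next_history · x') hp fun i => ?_
  filter_upwards [h.transition i x'] with ω hω hωD
  rw [← (hDsub i ω hωD).1, ← (hDsub i ω hωD).2]
  exact hω.ge

variable [Countable A]

theorem ae_pos (h : IsSampleStream M P η s a s') :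
    ∀ᵐ ω ∂P, ∀ i, 0 < M.p (s i ω) (a i ω) (s' i ω) := by
  have hne : ∀ i x, ∀ᵐ ω ∂P, M.p (s i ω) (a i ω) x = 0 → s' i ω ≠ x := fun i x =>
    ae_imp_notMem_of_condExp_indicator_eq_zero (h.history_le i)
      (measurable_transition M i x (measurableSet_singleton 0)) (h.measurableSet_next_eq i x)
      ((h.transition i x).mono fun _ hω hzero => hω.trans hzero)
  filter_upwards [ae_all_iff.2 fun i => ae_all_iff.2 (hne i)] with ω hω i
  exact (M.p_nonneg _ _ _).lt_of_ne' fun hzero => hω i _ hzero rfl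

open Classical in
theorem isBoundedMartingaleDifference (h : IsSampleStream M P η s a s') (x : S) :
    IsBoundedMartingaleDifference h.filtration P
      fun i ω => (if s' i ω = x then 1 else 0) - M.p (s i ω) (a i ω) x where
  measurable i := Measurable.sub
    (Measurable.ite (measurableSet_next_history i x) measurable_const measurable_const)
    ((measurable_transition M i x).mono (history_mono i.le_succ) le_rfl)
  abs_le_one i ω := by
    have hp := mem_Icc_of_mem_stdSimplex (p_mem_stdSimplex M (s i ω) (a i ω)) x
    rw [abs_le]
    split_ifs <;> constructor <;> linarith [hp.1, hp.2]
  condExp_eq_zero i := by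
    have hp : Measurable[history η s a s' i] fun ω => M.p (s i ω) (a i ω) x :=
      measurable_transition M i x
    have hint : Integrable (fun ω => M.p (s i ω) (a i ω) x) P :=
      Integrable.of_bound (hp.mono (h.history_le i) le_rfl).aestronglyMeasurable 1 <|
        Eventually.of_forall fun ω => by
          have hp := mem_Icc_of_mem_stdSimplex (p_mem_stdSimplex M (s i ω) (a i ω)) x
          rw [Real.norm_of_nonneg hp.1]
          exact hp.2
    have hsub := condExp_sub
      ((integrable_const (1 : ℝ)).indicator (h.measurableSet_next_eq i x)) hint
      (history η s a s' i)
    rw [condExp_of_stronglyMeasurable (h.history_le i) hp.stronglyMeasurable hint] at hsub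
    have heq : (fun ω => (if s' i ω = x then (1 : ℝ) else 0) - M.p (s i ω) (a i ω) x) =
        Set.indicator {ω | s' i ω = x} (fun _ => (1 : ℝ)) - fun ω => M.p (s i ω) (a i ω) x := by
      ext ω
      simp [Set.indicator_apply]
    rw [heq]
    filter_upwards [hsub, h.transition i x] with ω hω htrans
    exact hω.trans (sub_eq_zero.2 htrans)

end IsSampleStream

section Continuity

variable {S A : Type*} [Fintype A] [Nonempty A]

theorem continuous_maxQ (x : S) : Continuous fun q : S → A → ℝ => maxQ q x :=
  Continuous.finset_sup'_apply _ fun b _ => continuous_apply_apply x b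

theorem continuous_tdResidual [Fintype S] (M : MDP S A) (x : S) (b : A) (x' : S) :
    Continuous fun q => tdResidual M q x b x' :=
  (continuous_const.add (continuous_maxQ x')).sub (continuous_apply_apply x b)

end Continuity

section SampleRun

variable {S A Ω : Type*} [Fintype S] [Fintype A] [Nonempty A]

/-- The run of ERM Q-learning on the stream of samples observed at the outcome `ω`. -/
noncomputable abbrev sampleRun (M : MDP S A) (β zmin zmax : ℝ) (η : ℕ → Ω → ℝ) (s : ℕ → Ω → S)
    (a : ℕ → Ω → A) (s' : ℕ → Ω → S) (ω : Ω) : ℕ → Option (S → A → ℝ) :=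
  qIter M β zmin zmax (fun j => η j ω) (fun j => s j ω) (fun j => a j ω) (fun j => s' j ω)

/-- The iterates of `sampleRun`, set to `0` once the run has stopped. -/
noncomputable def sampleValue (M : MDP S A) (β zmin zmax : ℝ) (η : ℕ → Ω → ℝ) (s : ℕ → Ω → S)
    (a : ℕ → Ω → A) (s' : ℕ → Ω → S) (i : ℕ) (ω : Ω) : S → A → ℝ :=
  (sampleRun M β zmin zmax η s a s' ω i).getD 0

variable {η : ℕ → Ω → ℝ} {s : ℕ → Ω → S} {a : ℕ → Ω → A} {s' : ℕ → Ω → S}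

theorem sampleValue_succ_apply (M : MDP S A) (β zmin zmax : ℝ) (i : ℕ) (ω : Ω) (x : S) (b : A) :
    sampleValue M β zmin zmax η s a s' (i + 1) ω x b =
      if (sampleRun M β zmin zmax η s a s' ω (i + 1)).isSome then
        sampleValue M β zmin zmax η s a s' i ω x b - visitStep (η i ω) (s i ω) (a i ω) x b *
          (Real.exp (-β * tdResidual M (sampleValue M β zmin zmax η s a s' i ω) x b (s' i ω)) - 1)
      else 0 := by
  split_ifs with h
  · exact getD_qStep h x b
  · rw [sampleValue, Option.not_isSome_iff_eq_none.1 h]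
    rfl

theorem measurable_sampleRun (M : MDP S A) (β zmin zmax : ℝ) (i : ℕ) :
    MeasurableSet[history η s a s' i] {ω | (sampleRun M β zmin zmax η s a s' ω i).isSome} ∧
      Measurable[history η s a s' i] (sampleValue M β zmin zmax η s a s' i) := by
  induction i with
  | zero =>
    simp only [sampleRun, qIter, Option.isSome_some, Set.ofPred_true]
    exact ⟨@MeasurableSet.univ _ (history η s a s' 0), measurable_const⟩
  | succ i ih =>
    have hle : history η s a s' i ≤ history η s a s' (i + 1) := history_mono i.le_succ
    have hV := ih.2.mono hle le_rfl
    have htd : ∀ x b x', Measurable[history η s a s' (i + 1)] fun ω =>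
        tdResidual M (sampleValue M β zmin zmax η s a s' i ω) x b x' := fun x b x' =>
      (continuous_tdResidual M x b x').measurable.comp hV
    have hsome : MeasurableSet[history η s a s' (i + 1)]
        {ω | (sampleRun M β zmin zmax η s a s' ω (i + 1)).isSome} := by
      simp only [sampleRun, qIter, isSome_qStep_iff]
      exact (hle _ ih.1).inter (measurable_apply_sample i htd measurableSet_Icc)
    let _ : MeasurableSpace Ω := history η s a s' (i + 1)
    refine ⟨hsome, measurable_pi_lambda _ fun x => measurable_pi_lambda _ fun b => ?_⟩
    simp only [sampleValue_succ_apply]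
    have hVxb := (measurable_pi_apply b).comp ((measurable_pi_apply x).comp hV)
    have hexp := measurable_apply_of_countable (measurable_next_history i) fun x' =>
      Real.measurable_exp.comp ((htd x b x').const_mul (-β))
    exact Measurable.ite hsome (hVxb.sub (((measurable_visitStep i x b).mono hle le_rfl).mul
      (hexp.sub measurable_const))) measurable_const

theorem measurable_tdResidual_sampleValue (M : MDP S A) (β zmin zmax : ℝ) (i : ℕ) (x : S) (b : A)
    (x' : S) : Measurable[history η s a s' i] fun ω =>
      tdResidual M (sampleValue M β zmin zmax η s a s' i ω) x b x' :=
  (continuous_tdResidual M x b x').measurable.comp (measurable_sampleRun M β zmin zmax i).2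

theorem measurable_noiseCoeff (M : MDP S A) (β zmin zmax : ℝ) (i : ℕ) (x : S) (b : A) (x' : S) :
    Measurable[history η s a s' i] fun ω => noiseCoeff M β zmin zmax (η i ω)
      (sampleValue M β zmin zmax η s a s' i ω) (s i ω) (a i ω) x b x' :=
  have htd := measurable_tdResidual_sampleValue M β zmin zmax i x b x'
  Measurable.ite (htd measurableSet_Icc) ((measurable_visitStep i x b).mul
    (Real.measurable_exp.comp (measurable_const.mul htd))) measurable_const

end SampleRun

section AlmostSure

variable {S A Ω : Type*} [mΩ : MeasurableSpace Ω] [Fintype S] {M : MDP S A} {P : Measure Ω}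
  {η : ℕ → Ω → ℝ} {s : ℕ → Ω → S} {a : ℕ → Ω → A} {s' : ℕ → Ω → S}

theorem RobbinsMonro.ae_visitStep (h : RobbinsMonro M P η s a) :
    ∀ᵐ ω ∂P, (∀ i, 0 ≤ η i ω) ∧ ∀ x, x ≠ M.sink → ∀ b,
      ¬ Summable (fun i => visitStep (η i ω) (s i ω) (a i ω) x b) ∧
      Summable fun i => visitStep (η i ω) (s i ω) (a i ω) x b ^ 2 := by
  filter_upwards [h] with ω hω
  refine ⟨hω.1, fun x hx b => ⟨(hω.2 x hx b).1, ?_⟩⟩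
  simpa only [visitStep, ite_pow, zero_pow two_ne_zero] using (hω.2 x hx b).2

variable [Fintype A] [Nonempty A] [IsFiniteMeasure P]

open Classical in
theorem IsSampleStream.ae_exists_tendsto_noise (h : IsSampleStream M P η s a s')
    (hRM : RobbinsMonro M P η s a) {β : ℝ} (hβ : 0 ≤ β) (zmin zmax : ℝ) {x : S}
    (hx : x ≠ M.sink) (b : A) (x' : S) :
    ∀ᵐ ω ∂P, ∃ N, Tendsto (fun i => ∑ j ∈ Finset.range i,
      noiseCoeff M β zmin zmax (η j ω) (sampleValue M β zmin zmax η s a s' j ω) (s j ω) (a j ω)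
        x b x' * ((if s' j ω = x' then 1 else 0) - M.p (s j ω) (a j ω) x')) atTop (𝓝 N) := by
  refine (h.isBoundedMartingaleDifference x').ae_exists_tendsto
    (fun i => measurable_noiseCoeff M β zmin zmax i x b x') ?_
  filter_upwards [hRM.ae_visitStep] with ω hω
  exact Summable.of_nonneg_of_le (fun i => sq_nonneg _)
    (fun i => noiseCoeff_sq_le M hβ zmin zmax _ _ _ _ x b x') ((hω.2 x hx b).2.mul_left _)

/-- If the residual of a possible next state `x'` were outside the bounds at infinitely many
visits, then `x'` would be sampled at one of them and stop the run. -/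
theorem IsSampleStream.ae_eventually_tdResidual_mem (h : IsSampleStream M P η s a s')
    (β zmin zmax : ℝ) {x : S} {b : A} {x' : S} (hp : 0 < M.p x b x') :
    ∀ᵐ ω ∂P, (∀ i, (sampleRun M β zmin zmax η s a s' ω i).isSome) →
      ∀ᶠ i in atTop, s i ω = x ∧ a i ω = b →
        tdResidual M (sampleValue M β zmin zmax η s a s' i ω) x b x' ∈ Set.Icc zmin zmax := by
  filter_upwards [h.ae_eventually_notMem hp (D := fun i => {ω | s i ω = x ∧ a i ω = b} ∩
      {ω | tdResidual M (sampleValue M β zmin zmax η s a s' i ω) x b x' ∈ Set.Icc zmin zmax}ᶜ)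
    (fun i => (measurableSet_visit i x b).inter
      (measurable_tdResidual_sampleValue M β zmin zmax i x b x' measurableSet_Icc).compl)
    fun i ω hω => hω.1] with ω hω hrun
  refine (hω fun i hi hs' => hi.2 ?_).mono fun i hi hv => of_not_not fun hno => hi ⟨hv, hno⟩
  have hmem := (isSome_qStep_iff.1 (hrun (i + 1))).2
  simp only [hi.1.1, hi.1.2, hs'] at hmem
  exact hmem

theorem IsSampleStream.ae_isRegularRun (h : IsSampleStream M P η s a s')
    (hRM : RobbinsMonro M P η s a) {β : ℝ} (hβ : 0 ≤ β) (zmin zmax : ℝ) :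
    ∀ᵐ ω ∂P, (∀ i, (sampleRun M β zmin zmax η s a s' ω i).isSome) →
      IsRegularRun M β zmin zmax (fun j => η j ω) (fun j => s j ω) (fun j => a j ω)
        (fun j => s' j ω) fun j => sampleValue M β zmin zmax η s a s' j ω := by
  have hres := ae_all_iff.2 fun x => ae_all_iff.2 fun b => ae_all_iff.2 fun x' =>
    eventually_imp_distrib_left.2 fun hp : 0 < M.p x b x' =>
      h.ae_eventually_tdResidual_mem β zmin zmax hp
  have hnoise := ae_all_iff.2 fun x => eventually_imp_distrib_left.2 fun hx : x ≠ M.sink =>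
    ae_all_iff.2 fun b => ae_all_iff.2 fun x' => h.ae_exists_tendsto_noise hRM hβ zmin zmax hx b x'
  filter_upwards [hRM.ae_visitStep, h.ae_pos, hres, hnoise] with ω hstep hpos hres hnoise hrun
  exact
    { run i := (Option.some_get (hrun i)).symm.trans
        (congrArg some (Option.get_eq_getD _))
      step_nonneg := hstep.1
      not_summable_step x hx b := (hstep.2 x hx b).1
      summable_step_sq x hx b := (hstep.2 x hx b).2
      p_pos := hpos
      residual_mem x b x' hp := hres x b x' hp hrun
      noise := hnoise }

end AlmostSure

section RunConverges

variable {S A : Type*} [Fintype S] [Fintype A] [Nonempty A]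

theorem qIter_isSome_of_tdResidual_mem {M : MDP S A} {β zmin zmax : ℝ} {η : ℕ → ℝ} {s : ℕ → S}
    {a : ℕ → A} {s' : ℕ → S}
    (hres : ∀ i q, qIter M β zmin zmax η s a s' i = some q →
      tdResidual M q (s i) (a i) (s' i) ∈ Set.Icc zmin zmax) (i : ℕ) :
    (qIter M β zmin zmax η s a s' i).isSome := by
  induction i with
  | zero => rfl
  | succ i ih =>
    obtain ⟨q, hq⟩ := Option.isSome_iff_exists.1 ih
    rw [qIter, isSome_qStep_iff, hq]
    exact ⟨rfl, hres i q hq⟩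

theorem runConverges_none_of_eq_none {M : MDP S A} {β zmin zmax : ℝ} {η : ℕ → ℝ} {s : ℕ → S}
    {a : ℕ → A} {s' : ℕ → S} {i : ℕ} (hi : qIter M β zmin zmax η s a s' i = none) :
    RunConverges (qIter M β zmin zmax η s a s') none := by
  refine eventually_atTop.2 ⟨i, fun j hj => ?_⟩
  induction j, hj using Nat.le_induction with
  | base => exact hi
  | succ j _ ih => rw [qIter, ih, qStep]

variable {run : ℕ → Option (S → A → ℝ)} {Q : Option (S → A → ℝ)}

theorem RunConverges.tendsto_hEst (h : RunConverges run Q) (M : MDP S A) (α β : ℝ) :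
    Tendsto (fun i => hEst M α β (run i)) atTop (𝓝 (hEst M α β Q)) := by
  cases Q with
  | none => exact tendsto_const_nhds.congr' (h.mono fun i hi => by simp only [hi])
  | some q =>
    obtain ⟨qs, hqs, hlim⟩ := h
    simp only [hqs, hEst]
    have hcont : Continuous fun q : S → A → ℝ => erm M.μ β (maxQ q) :=
      (continuous_erm (μ_mem_stdSimplex M) β).comp (continuous_pi continuous_maxQ)
    exact (continuous_coe_real_ereal.tendsto _).comp
      (((hcont.tendsto q).comp hlim).add_const _)

end RunConverges

section Greedy

variable {S A : Type*} [Finite S] [Finite A]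

theorem RunConverges.eventually_greedy {run : ℕ → Option (S → A → ℝ)} {Q : Option (S → A → ℝ)}
    (h : RunConverges run Q) : ∀ᶠ i in atTop, ∀ π, Greedy (run i) π → Greedy Q π := by
  cases Q with
  | none => exact Eventually.of_forall fun _ _ _ => trivial
  | some q =>
    obtain ⟨qs, hqs, hlim⟩ := h
    have hlim' (x : S) (b : A) : Tendsto (fun i => qs i x b) atTop (𝓝 (q x b)) :=
      tendsto_pi_nhds.1 (tendsto_pi_nhds.1 hlim x) b
    have hlt : ∀ᶠ i in atTop, ∀ x b c, q x c < q x b → qs i x c < qs i x b := by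
      simp only [eventually_all]
      exact fun x b c hbc => (hlim' x c).eventually_lt (hlim' x b) hbc
    filter_upwards [hlt] with i hi π hπ x b
    rw [hqs] at hπ
    exact le_of_not_gt fun hgt => (hi x b (π x) hgt).not_ge (hπ x b)

end Greedy

section Output

variable {S A : Type*} [Fintype S] [Fintype A] [Nonempty A]

theorem eventually_evarOutput (M : MDP S A) (α : ℝ) (B : Finset ℝ)
    {run : ℝ → ℕ → Option (S → A → ℝ)} {Q : ℝ → Option (S → A → ℝ)}
    (h : ∀ β ∈ B, RunConverges (run β) (Q β)) :
    ∀ᶠ i in atTop, ∀ π, EvarOutput M α B (fun β => run β i) π → EvarOutput M α B Q π := by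
  have hgreedy : ∀ᶠ i in atTop, ∀ β ∈ B, ∀ π, Greedy (run β i) π → Greedy (Q β) π :=
    (eventually_all_finset B).2 fun β hβ => (h β hβ).eventually_greedy
  have hlt : ∀ᶠ i in atTop, ∀ β ∈ B, ∀ β' ∈ B, hEst M α β (Q β) < hEst M α β' (Q β') →
      hEst M α β (run β i) < hEst M α β' (run β' i) := by
    simp only [eventually_all_finset, eventually_imp_distrib_left]
    exact fun β hβ β' hβ' =>
      ((h β hβ).tendsto_hEst M α β).eventually_lt ((h β' hβ').tendsto_hEst M α β')
  filter_upwards [hgreedy, hlt] with i hgreedy hlt π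
  rintro ⟨β, hβ, hmax, hπ⟩
  exact ⟨β, hβ, fun β' hβ' => le_of_not_gt fun hgt => (hlt β hβ β' hβ' hgt).not_ge (hmax β' hβ'),
    hgreedy β hβ π hπ⟩

variable {M : MDP S A} {α β δ : ℝ}

/-- An estimate of the state-action values for the risk level `β` from which `h⋆(β)` is recovered
exactly and, unless `h⋆(β) = -∞`, greedy policies attain it. -/
structure IsOptimalEstimate (M : MDP S A) (α β : ℝ) (Q : Option (S → A → ℝ)) : Prop where
  hEst_eq : hEst M α β Q = hStar M α β
  hVal_eq_of_greedy : hStar M α β ≠ ⊥ → ∀ π, Greedy Q π → hVal M α π β = hStar M α β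

theorem isOptimalEstimate_none (h : hStar M α β = ⊥) : IsOptimalEstimate M α β none :=
  ⟨h.symm, fun hne => absurd h hne⟩

theorem IsBellmanSolution.isOptimalEstimate [DecidableEq S] {q : S → A → ℝ}
    (hq : IsBellmanSolution M β q) (hM : Transient M) (hβ : 0 < β) :
    IsOptimalEstimate M α β (some q) :=
  ⟨hq.hEst_eq_hStar hM hβ, fun _ _ hπ =>
    (hq.hVal_eq_hEst_of_greedy hM hπ).trans (hq.hEst_eq_hStar hM hβ)⟩

theorem EvarOutput.deltaOptimal [DecidableEq S] {B : Finset ℝ} {Q : ℝ → Option (S → A → ℝ)}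
    {π : S → A} (h : EvarOutput M α B Q π) (hM : Transient M) (hα₀ : 0 < α) (hα₁ : α < 1)
    (hB : ∀ β ∈ B, 0 < β) (hQ : ∀ β ∈ B, IsOptimalEstimate M α β (Q β))
    (hle : ∀ β ∈ B, (∀ β' ∈ B, hStar M α β' ≤ hStar M α β) →
      ∀ π', evarTotal M α π' ≤ hStar M α β + δ) : DeltaOptimal M α δ π := by
  obtain ⟨β, hβ, hmax, hπ⟩ := h
  have hmax' : ∀ β' ∈ B, hStar M α β' ≤ hStar M α β := fun β' hβ' => by
    simpa only [(hQ β hβ).hEst_eq, (hQ β' hβ').hEst_eq] using hmax β' hβ'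
  have hne := hM.hStar_ne_bot_of_evarTotal_le (hle β hβ hmax' π)
  exact .of_hVal_eq_hStar hM hα₀ hα₁ (hB β hβ) (hle β hβ hmax')
    ((hQ β hβ).hVal_eq_of_greedy hne π hπ)

end Output

section Convergence

variable {S A Ω : Type*} [Fintype S] [DecidableEq S] [Fintype A] [Nonempty A] [MeasurableSpace Ω]
  {M : MDP S A} {α : ℝ} {P : Measure Ω} [IsFiniteMeasure P] {η : ℕ → Ω → ℝ} {s : ℕ → Ω → S}
  {a : ℕ → Ω → A} {s' : ℕ → Ω → S}

theorem IsSampleStream.ae_exists_runConverges (h : IsSampleStream M P η s a s')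
    (hRM : RobbinsMonro M P η s a) (hM : Transient M) {β : ℝ} (hβ : 0 < β) (zmin zmax : ℝ)
    (hres : hStar M α β ≠ ⊥ → ∀ᵐ ω ∂P, ∀ i q, sampleRun M β zmin zmax η s a s' ω i = some q →
      tdResidual M q (s i ω) (a i ω) (s' i ω) ∈ Set.Icc zmin zmax) :
    ∀ᵐ ω ∂P, ∃ Q, RunConverges (sampleRun M β zmin zmax η s a s' ω) Q ∧
      IsOptimalEstimate M α β Q := by
  filter_upwards [eventually_imp_distrib_left.2 hres, h.ae_isRegularRun hRM hβ.le zmin zmax]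
    with ω hmem hreg
  by_cases hrun : ∀ i, (sampleRun M β zmin zmax η s a s' ω i).isSome
  · obtain ⟨q, hlim, hq⟩ := (hreg hrun).exists_tendsto hM hβ
    exact ⟨some q, ⟨_, (hreg hrun).run, hlim⟩, hq.isOptimalEstimate hM hβ⟩
  · obtain ⟨i, hi⟩ := not_forall.1 hrun
    exact ⟨none, runConverges_none_of_eq_none (Option.not_isSome_iff_eq_none.1 hi),
      isOptimalEstimate_none (of_not_not fun hne =>
        hrun (qIter_isSome_of_tdResidual_mem (hmem hne)))⟩

end Convergence

end TRC

theorem mainTheorem2 {S A : Type*} [Fintype S] [DecidableEq S] [Fintype A] [Nonempty A]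
    (M : TRC.MDP S A) (hM : TRC.Transient M)
    (α : ℝ) (hα₀ : 0 < α) (hα₁ : α < 1) (δ : ℝ) (hδ : 0 < δ) :
    ∃ βbar : ℝ, 0 < βbar ∧ ∀ β₀ : ℝ, 0 < β₀ → β₀ ≤ βbar →
      ∀ {Ω : Type*} [MeasurableSpace Ω] (P : Measure Ω) [IsProbabilityMeasure P]
        (η : ℕ → Ω → ℝ) (s : ℕ → Ω → S) (a : ℕ → Ω → A) (s' : ℕ → Ω → S)
        (zmin zmax : ℝ → ℝ),
        TRC.IsSampleStream M P η s a s' →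
        TRC.RobbinsMonro M P η s a →
        (∀ β ∈ TRC.grid α δ β₀, TRC.hStar M α β ≠ ⊥ →
          ∀ᵐ ω ∂P, ∀ i : ℕ, ∀ q : S → A → ℝ,
            TRC.qIter M β (zmin β) (zmax β) (fun j => η j ω) (fun j => s j ω)
              (fun j => a j ω) (fun j => s' j ω) i = some q →
            TRC.tdResidual M q (s i ω) (a i ω) (s' i ω) ∈ Set.Icc (zmin β) (zmax β)) →
        ∀ᵐ ω ∂P, ∃ Q : ℝ → Option (S → A → ℝ),
          (∀ β ∈ TRC.grid α δ β₀,
            TRC.RunConverges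
              (TRC.qIter M β (zmin β) (zmax β) (fun j => η j ω) (fun j => s j ω)
                (fun j => a j ω) (fun j => s' j ω)) (Q β) ∧
            TRC.hEst M α β (Q β) = TRC.hStar M α β) ∧
          (∀ π : S → A, TRC.EvarOutput M α (TRC.grid α δ β₀) Q π →
            TRC.DeltaOptimal M α δ π) ∧
          ∀ᶠ i in atTop, ∀ π : S → A,
            TRC.EvarOutput M α (TRC.grid α δ β₀)
              (fun β => TRC.qIter M β (zmin β) (zmax β) (fun j => η j ω) (fun j => s j ω)
                (fun j => a j ω) (fun j => s' j ω) i) π →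
            TRC.DeltaOptimal M α δ π := by
  obtain ⟨βbar, hβbar, hgrid⟩ := mem_nhdsGT_iff_exists_Ioc_subset.1
    (hM.eventually_evarTotal_le_hStar hα₀ hα₁ hδ)
  refine ⟨βbar, hβbar, fun β₀ hβ₀ hle Ω _ P _ η s a s' zmin zmax hstream hRM hres => ?_⟩
  have hpos : ∀ β ∈ TRC.grid α δ β₀, 0 < β := fun β => TRC.pos_of_mem_grid hα₀ hα₁ hδ hβ₀
  have hconv := (ae_ball_iff (TRC.grid α δ β₀).countable_toSet).2 fun β hβ =>
    hstream.ae_exists_runConverges hRM hM (hpos β hβ) (zmin β) (zmax β) (hres β hβ)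
  filter_upwards [hconv] with ω hω
  choose! Q hrun hQ using hω
  have houtput : ∀ π, TRC.EvarOutput M α (TRC.grid α δ β₀) Q π → TRC.DeltaOptimal M α δ π :=
    fun π hπ => hπ.deltaOptimal hM hα₀ hα₁ hpos hQ (hgrid ⟨hβ₀, hle⟩)
  exact ⟨Q, fun β hβ => ⟨hrun β hβ, (hQ β hβ).hEst_eq⟩, houtput,
    (TRC.eventually_evarOutput M α _ hrun).mono fun i hi π hπ => houtput π (hi π hπ)⟩
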